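/- Let $\Sigma$ be a finite alphabet, $\lambda\in\Sigma$ a letter and $\mathcal S$ a set of finite monoids. Each finite monoid $M=\{m_1,\dots,m_K,1\}$ comes with a fixed enumeration $m_1,\dots,m_K$ of its non-identity elements. Let $\mathcal L_{\mathcal S}[<,+]$ be the logic whose terms are the expressions $\alpha_0+\alpha_1x_1+\dots+\alpha_nx_n$ with $\alpha_i\in\mathbb N$, whose atomic formulas are $c(\sigma)$ ($c\in\Sigma$), $\sigma=\tau$, $\sigma<\tau$ and $\sigma\equiv_q\tau$ ($q>1$) for terms $\sigma,\tau$, and which is closed under $\neg,\wedge,\vee$ and the monoid quantifiers $Q_M^m x\,\langle\varphi_1,\dots,\varphi_K\rangle$ with $M\in\mathcal S$, $m\in M$. Formulas are evaluated in infinite words $w=w(0)w(1)w(2)\cdots$ over $\Sigma$, with variables ranging over $\mathbb N$; $c(\sigma)$ says that the letter at position $\sigma$ is $c$, and $\sigma\equiv_q\tau$ says that $q\mid\tau-\sigma$. The formula $Q_M^m x\,\langle\varphi_1,\dots,\varphi_K\rangle$ holds in $w$ iff $u(0)u(1)\cdots u(k-1)=m$ for all sufficiently large $k$, where $u(i)=m_j$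 for the least $j$ such that $\varphi_j$ holds at $x=i$, and $u(i)=1$ if there is no such $j$. (If $M$ is a group, this means that $u(i)\neq 1$ for only finitely many $i$ and that the ordered product of the $u(i)$ is $m$.) A formula is an active domain formula if each of its quantifiers has the form $Q_M^m x\,\langle\neg\lambda(x)\wedge\alpha_1,\dots,\neg\lambda(x)\wedge\alpha_K\rangle$. Put $\mathrm{nnp}(w)=\{i : w(i)\ne\lambda\}$ and $\mathcal D_r=\{r^i : i\geq 1\}$. A formula $\varphi(x_1,\dots,x_t)$ of $\mathcal L_{\mathcal S}[<,+]$ collapses to $\varphi'(x_1,\dots,x_t)$ if $\varphi'$ is an active domain formula of $\mathcal L_{\mathcal S}[<,+]$ and there is an $R\in\mathbb N$ such that for all $r\ge R$, all $w\in\Sigma^*\lambda^\omega$ with $\mathrm{nnp}(w)\subseteq\mathcal D_r$ and all $a_1,\dots,a_t\in\mathbb N$, $$w\models\varphi(a_1,\dots,a_t)\iff w\models\varphi'(a_1,\dots,a_t).$$ **Lemma.** Let $\varphi=Q_G^m z\,\langle\varphi_1,\dots,\varphi_K\rangle$ be a formula of $\mathcal L_{\mathcal S}[<,+]$, where $G$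 is a finite group and $m\in G$, and suppose that $\varphi_1,\dots,\varphi_K$ collapse to $\varphi_1',\dots,\varphi_K'$. Then $\varphi$ collapses to an active domain formula $\varphi'$ of $\mathcal L_{\mathcal S}[<,+]$ in which all quantifiers are quantifiers $Q_G^{g}$, $g\in G$, of the same group $G$ or quantifiers of monoids whose quantifiers occur in $\varphi_1',\dots,\varphi_K'$. -/

import Mathlib

namespace MonoidLogic

/-- A finite monoid `M = {m₁, …, m_K, 1}` together with the enumeration `m₁, …, m_K` of its
non-identity elements that the monoid quantifiers of `M` refer to. -/
structure FinMonoid where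
  carrier : Type
  [monoid : Monoid carrier]
  K : ℕ
  enum : Fin K ≃ {a : carrier // a ≠ 1}

attribute [instance] FinMonoid.monoid

open Classical in
/-- The element `m_j` for the least `j` such that `P j` holds, and `1` if there is no such `j`. -/
noncomputable def FinMonoid.pick (M : FinMonoid) (P : Fin M.K → Prop) : M.carrier :=
  match (List.finRange M.K).find? (fun j => decide (P j)) with
  | some j => (M.enum j).1
  | none => 1

/-- Terms `α₀ + α₁ x₁ + ⋯ + α_n x_n` (with natural coefficients) in the variables `Fin n`. -/
inductive Term (n : ℕ) : Type
  | var (i : Fin n) : Term n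
  | const (c : ℕ) : Term n
  | add (σ τ : Term n) : Term n

/-- The value of a term under an assignment of the variables. -/
def Term.eval {n : ℕ} : Term n → (Fin n → ℕ) → ℕ
  | .var i, v => v i
  | .const c, _ => c
  | .add σ τ, v => σ.eval v + τ.eval v

/-- Formulas over the alphabet `A` with free variables among `Fin n`, built from the predicates
`c(σ)` for letters `c`, `=`, `<` and `≡_q` for `q > 1`, the Boolean connectives and the monoid
quantifiers. In `quant M m φ`, the variable bound by the quantifier is the variable `0` of the
formulas `φ j`, and the variable `i` of `quant M m φ` is their variable `i + 1`. -/
inductive Formula (A : Type*) : ℕ → Type _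
  | letter {n : ℕ} (c : A) (σ : Term n) : Formula A n
  | eq {n : ℕ} (σ τ : Term n) : Formula A n
  | lt {n : ℕ} (σ τ : Term n) : Formula A n
  | modEq {n : ℕ} (q : ℕ) (hq : 1 < q) (σ τ : Term n) : Formula A n
  | neg {n : ℕ} (φ : Formula A n) : Formula A n
  | and {n : ℕ} (φ ψ : Formula A n) : Formula A n
  | or {n : ℕ} (φ ψ : Formula A n) : Formula A n
  | quant {n : ℕ} (M : FinMonoid) (m : M.carrier) (φ : Fin M.K → Formula A (n + 1)) : Formula A n

namespace Formula

variable {A : Type*}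

/-- `φ.Sat w v` means that the infinite word `w` satisfies `φ` under the assignment `v`.
For a quantifier with target `m`, the infinite product `u(0) u(1) u(2) ⋯` is equal to `m` when the
finite products `u(0) ⋯ u(k - 1)` are equal to `m` for all large `k`. (In a group this says that
only finitely many `u(i)` differ from `1` and that their product in increasing order is `m`; for
the monoid `{0, 1}` and `m = 0` it gives the existential quantifier.) -/
def Sat (w : ℕ → A) : {n : ℕ} → Formula A n → (Fin n → ℕ) → Prop
  | _, .letter c σ, v => w (σ.eval v) = c
  | _, .eq σ τ, v => σ.eval v = τ.eval v
  | _, .lt σ τ, v => σ.eval v < τ.eval v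
  | _, .modEq q _ σ τ, v => σ.eval v ≡ τ.eval v [MOD q]
  | _, .neg φ, v => ¬ φ.Sat w v
  | _, .and φ ψ, v => φ.Sat w v ∧ ψ.Sat w v
  | _, .or φ ψ, v => φ.Sat w v ∨ ψ.Sat w v
  | _, .quant M m φ, v => ∀ᶠ k in Filter.atTop,
      ((List.range k).map fun i => M.pick fun j => (φ j).Sat w (Fin.cons i v)).prod = m

/-- The monoids (with their enumerations) whose quantifiers occur in a formula. -/
def monoids : {n : ℕ} → Formula A n → Set FinMonoid
  | _, .letter _ _ => ∅
  | _, .eq _ _ => ∅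
  | _, .lt _ _ => ∅
  | _, .modEq _ _ _ _ => ∅
  | _, .neg φ => φ.monoids
  | _, .and φ ψ => φ.monoids ∪ ψ.monoids
  | _, .or φ ψ => φ.monoids ∪ ψ.monoids
  | _, .quant M _ φ => {M} ∪ ⋃ j, (φ j).monoids

/-- Membership in the logic `L_S[<, +, 0, {≡_q : q > 1}]`. -/
def InLogic (S : Set FinMonoid) {n : ℕ} (φ : Formula A n) : Prop :=
  φ.monoids ⊆ S

/-- Active domain formulas over the letter `lam`: every quantifier has the form
`Q_M^m x ⟨¬ lam(x) ∧ φ₁, …, ¬ lam(x) ∧ φ_K⟩`. -/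
inductive IsActiveDomain (lam : A) : {n : ℕ} → Formula A n → Prop
  | letter {n : ℕ} (c : A) (σ : Term n) : IsActiveDomain lam (.letter c σ)
  | eq {n : ℕ} (σ τ : Term n) : IsActiveDomain lam (.eq σ τ)
  | lt {n : ℕ} (σ τ : Term n) : IsActiveDomain lam (.lt σ τ)
  | modEq {n : ℕ} (q : ℕ) (hq : 1 < q) (σ τ : Term n) : IsActiveDomain lam (.modEq q hq σ τ)
  | neg {n : ℕ} {φ : Formula A n} (hφ : IsActiveDomain lam φ) : IsActiveDomain lam (.neg φ)
  | and {n : ℕ} {φ ψ : Formula A n} (hφ : IsActiveDomain lam φ) (hψ : IsActiveDomain lam ψ) :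
      IsActiveDomain lam (.and φ ψ)
  | or {n : ℕ} {φ ψ : Formula A n} (hφ : IsActiveDomain lam φ) (hψ : IsActiveDomain lam ψ) :
      IsActiveDomain lam (.or φ ψ)
  | quant {n : ℕ} (M : FinMonoid) (m : M.carrier) {φ : Fin M.K → Formula A (n + 1)}
      (hφ : ∀ j, IsActiveDomain lam (φ j)) :
      IsActiveDomain lam (.quant M m fun j => .and (.neg (.letter lam (.var 0))) (φ j))

end Formula

/-- The non-neutral positions of an infinite word. The words in `A^* lam^ω` are the words for which
this set is finite. -/
def nnp {A : Type*} (lam : A) (w : ℕ → A) : Set ℕ :=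
  {i | w i ≠ lam}

/-- The set `D_r` of powers of `r` with positive exponent. -/
def powers (r : ℕ) : Set ℕ :=
  {d | ∃ i : ℕ, 0 < i ∧ d = r ^ i}

/-- `φ` collapses to `φ'` in the logic over `S`, with neutral letter `lam`. -/
def CollapsesTo {A : Type*} (S : Set FinMonoid) (lam : A) {t : ℕ} (φ φ' : Formula A t) : Prop :=
  φ'.IsActiveDomain lam ∧ φ'.InLogic S ∧
    ∃ R : ℕ, ∀ r : ℕ, R ≤ r → ∀ w : ℕ → A, (nnp lam w).Finite → nnp lam w ⊆ powers r →
      ∀ a : Fin t → ℕ, φ.Sat w a ↔ φ'.Sat w a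

end MonoidLogic

/-! Replace each `φ j` by its active domain version, and let `f z` be the group element picked at
`z`. Away from exceptional points, `f` is periodic in `z` with some period `Q`
(`Formula.IsActiveDomain.locally_periodic`). The exceptional points lie near zeros of bounded
integer linear forms in `z`, the parameters and finitely many active positions. A window of length
`N = Q * |G|` that avoids them contributes the `|G|`-th power of one period product, hence `1`
(`rangeProd_eq_one_of_periodic`). Cutting the infinite product into such windows, once for every
residue modulo `N`, leaves only the windows that start at exceptional points
(`eventually_rangeProd_eq_iff`).

These points are covered by finitely many chains, the solutions of `α z = p - q + β₁ y₁ + ⋯ + β_k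
y_k` with active `y₁ > ⋯ > y_k` and nonzero `β_i` (`exists_chains_of_nearZero`). As active positions
are powers of a large `r`, the sum is dominated by its leading term. The solutions therefore form
blocks indexed by `y₁`, in the order of `y₁` or in the reverse order according to the sign of `β₁`
(`chainSums_lt`, `chainSums_gt`). So the product over one chain is an iterated active domain product
over `y₁`, `y₂`, ..., where reversed order is handled by inverses
(`DefinableFun.limProd_chainPoints`).

Different chains may interleave. Their factors are separated by conjugation: in a product of `b z *
c z`, all `c` move to the right once each `b z` is conjugated by the product of the earlier `c`
(`rangeProd_mul_eq_conj`). Induction on the number of chains then gives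
`DefinableFun.limProd_chains`. -/

namespace MonoidLogic

/-! ### Finite ordered products and their eventual values. -/

section Products

/-- The finite product `g 0 * ⋯ * g (n - 1)`. -/
def rangeProd {H : Type*} [Monoid H] (g : ℕ → H) (n : ℕ) : H :=
  ((List.range n).map g).prod

@[simp] theorem rangeProd_zero {H : Type*} [Monoid H] (g : ℕ → H) : rangeProd g 0 = 1 := by
  simp [rangeProd]

theorem rangeProd_succ {H : Type*} [Monoid H] (g : ℕ → H) (n : ℕ) :
    rangeProd g (n + 1) = rangeProd g n * g n := by
  simp [rangeProd, List.range_succ]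

theorem rangeProd_congr {H : Type*} [Monoid H] {g h : ℕ → H} {n : ℕ}
    (hgh : ∀ i < n, g i = h i) : rangeProd g n = rangeProd h n := by
  induction n with
  | zero => simp
  | succ n ih =>
    rw [rangeProd_succ, rangeProd_succ, ih fun i hi => hgh i (by omega), hgh n (by omega)]

theorem rangeProd_eq_one {H : Type*} [Monoid H] {g : ℕ → H} {n : ℕ}
    (hg : ∀ i < n, g i = 1) : rangeProd g n = 1 := by
  rw [rangeProd_congr hg]
  induction n with
  | zero => simp
  | succ n ih => rw [rangeProd_succ, ih fun i hi => hg i (by omega), mul_one]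

theorem rangeProd_add {H : Type*} [Monoid H] (g : ℕ → H) (m n : ℕ) :
    rangeProd g (m + n) = rangeProd g m * rangeProd (fun i => g (m + i)) n := by
  induction n with
  | zero => simp
  | succ n ih => rw [← add_assoc, rangeProd_succ, ih, rangeProd_succ, mul_assoc]

theorem rangeProd_mul {H : Type*} [Monoid H] (g : ℕ → H) (m n : ℕ) :
    rangeProd g (m * n) = rangeProd (fun k => rangeProd (fun i => g (m * k + i)) m) n := by
  induction n with
  | zero => simp
  | succ n ih => rw [Nat.mul_succ, rangeProd_add, ih, rangeProd_succ]

/-- A product of periodic factors over `|H|` periods is trivial. -/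
theorem rangeProd_eq_one_of_periodic {H : Type*} [Group H] {g : ℕ → H} {q : ℕ}
    (hg : ∀ i, i + q < q * Nat.card H → g i = g (i + q)) :
    rangeProd g (q * Nat.card H) = 1 := by
  -- Every period repeats the first one, so the product is the `Nat.card H`-th power of a single
  -- period product.
  have key : ∀ k, k < Nat.card H → ∀ i < q, g (q * k + i) = g i := by
    intro k
    induction k with
    | zero => simp
    | succ k ih =>
      intro hk i hi
      rw [← ih (by omega) i hi, hg (q * k + i) ?_]
      · congr 1; ring
      · calc q * k + i + q < q * (k + 1 + 1) := by nlinarith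
          _ ≤ q * Nat.card H := Nat.mul_le_mul_left _ hk
  rw [rangeProd_mul]
  have : ∀ k ≤ Nat.card H,
      rangeProd (fun k => rangeProd (fun i => g (q * k + i)) q) k = rangeProd g q ^ k := by
    intro k hk
    induction k with
    | zero => simp
    | succ k ih =>
      rw [rangeProd_succ, ih (by omega), pow_succ, rangeProd_congr (key k (by omega))]
  rw [this _ le_rfl, pow_card_eq_one']

/-- The product of the factors of `b * c`, with the factors `c` collected on the right. -/
theorem rangeProd_mul_eq_conj {H : Type*} [Group H] (b c : ℕ → H) (n : ℕ) :
    rangeProd (fun z => b z * c z) n =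
      rangeProd (fun z => rangeProd c z * b z * (rangeProd c z)⁻¹) n * rangeProd c n := by
  induction n with
  | zero => simp
  | succ n ih => rw [rangeProd_succ, ih, rangeProd_succ, rangeProd_succ c]; group

open Classical in
theorem rangeProd_union {H : Type*} [Monoid H] (g : ℕ → H) {S T : Set ℕ}
    (hST : ∀ s ∈ S, ∀ t ∈ T, s < t) (n : ℕ) :
    rangeProd (fun z => if z ∈ S ∨ z ∈ T then g z else 1) n =
      rangeProd (fun z => if z ∈ S then g z else 1) n *
        rangeProd (fun z => if z ∈ T then g z else 1) n := by
  induction n with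
  | zero => simp
  | succ n ih =>
    simp only [rangeProd_succ, ih]
    by_cases hS : n ∈ S
    · have h1 : rangeProd (fun z => if z ∈ T then g z else 1) n = 1 :=
        rangeProd_eq_one fun i hi => if_neg fun hT => absurd (hST n hS i hT) (by omega)
      have h2 : n ∉ T := fun hT => lt_irrefl _ (hST n hS n hT)
      simp [h1, h2, hS]
    · simp [hS, mul_assoc]

open Classical in
theorem rangeProd_biUnion {H : Type*} [Monoid H] (g : ℕ → H) {D : Set ℕ} {B : ℕ → Set ℕ}
    (hB : ∀ y ∈ D, ∀ y' ∈ D, y < y' → ∀ z ∈ B y, ∀ z' ∈ B y', z < z') (n k : ℕ) :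
    rangeProd (fun z => if ∃ y ∈ D, y < k ∧ z ∈ B y then g z else 1) n =
      rangeProd (fun y => if y ∈ D then
        rangeProd (fun z => if z ∈ B y then g z else 1) n else 1) k := by
  induction k with
  | zero => simpa using rangeProd_eq_one (n := n) (g := fun _ => (1 : H)) fun _ _ => rfl
  | succ k ih =>
    rw [rangeProd_succ, ← ih]
    by_cases hk : k ∈ D
    · rw [if_pos hk]
      have := rangeProd_union g (S := {z | ∃ y ∈ D, y < k ∧ z ∈ B y}) (T := B k)
        (fun s ⟨y, hy, hyk, hs⟩ t ht => hB y hy k hk hyk s hs t ht) n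
      simp only [Set.mem_ofPred_eq] at this
      rw [← this]
      refine rangeProd_congr fun i _ => if_congr ?_ rfl rfl
      constructor
      · rintro ⟨y, hy, hyk, h⟩
        rcases Nat.lt_succ_iff_lt_or_eq.1 hyk with h' | rfl
        exacts [Or.inl ⟨y, hy, h', h⟩, Or.inr h]
      · rintro (⟨y, hy, hyk, h⟩ | h)
        exacts [⟨y, hy, by omega, h⟩, ⟨k, hk, by omega, h⟩]
    · rw [if_neg hk, mul_one]
      refine rangeProd_congr fun i _ => if_congr ?_ rfl rfl
      constructor
      · rintro ⟨y, hy, hyk, h⟩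
        rcases Nat.lt_succ_iff_lt_or_eq.1 hyk with h' | rfl
        exacts [⟨y, hy, h', h⟩, absurd hy hk]
      · rintro ⟨y, hy, hyk, h⟩
        exact ⟨y, hy, by omega, h⟩

-- When the blocks descend as `y` grows, the ordered product runs through them backwards. In a group
-- this is the inverse of the forward product of the inverted block products.
open Classical in
theorem rangeProd_biUnion_of_gt {H : Type*} [Group H] (g : ℕ → H) {D : Set ℕ} {B : ℕ → Set ℕ}
    (hB : ∀ y ∈ D, ∀ y' ∈ D, y < y' → ∀ z ∈ B y, ∀ z' ∈ B y', z' < z) (n k : ℕ) :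
    rangeProd (fun z => if ∃ y ∈ D, y < k ∧ z ∈ B y then g z else 1) n =
      (rangeProd (fun y => if y ∈ D then
        (rangeProd (fun z => if z ∈ B y then g z else 1) n)⁻¹ else 1) k)⁻¹ := by
  induction k with
  | zero => simpa using rangeProd_eq_one (n := n) (g := fun _ => (1 : H)) fun _ _ => rfl
  | succ k ih =>
    rw [rangeProd_succ, mul_inv_rev, ← ih]
    by_cases hk : k ∈ D
    · rw [if_pos hk, inv_inv]
      have := rangeProd_union g (T := {z | ∃ y ∈ D, y < k ∧ z ∈ B y}) (S := B k)
        (fun t ht s ⟨y, hy, hyk, hs⟩ => hB y hy k hk hyk s hs t ht) n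
      simp only [Set.mem_ofPred_eq] at this
      rw [← this]
      refine rangeProd_congr fun i _ => if_congr ?_ rfl rfl
      constructor
      · rintro ⟨y, hy, hyk, h⟩
        rcases Nat.lt_succ_iff_lt_or_eq.1 hyk with h' | rfl
        exacts [Or.inr ⟨y, hy, h', h⟩, Or.inl h]
      · rintro (h | ⟨y, hy, hyk, h⟩)
        exacts [⟨k, hk, by omega, h⟩, ⟨y, hy, by omega, h⟩]
    · rw [if_neg hk, inv_one, one_mul]
      refine rangeProd_congr fun i _ => if_congr ?_ rfl rfl
      constructor
      · rintro ⟨y, hy, hyk, h⟩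
        rcases Nat.lt_succ_iff_lt_or_eq.1 hyk with h' | rfl
        exacts [⟨y, hy, h', h⟩, absurd hy hk]
      · rintro ⟨y, hy, hyk, h⟩
        exact ⟨y, hy, by omega, h⟩

open Classical in
/-- The eventual value of the products `rangeProd g n`, and `1` if there is none. -/
noncomputable def limProd {H : Type*} [Monoid H] (g : ℕ → H) : H :=
  if h : ∃ m, ∀ᶠ n in Filter.atTop, rangeProd g n = m then h.choose else 1

theorem limProd_eq {H : Type*} [Monoid H] {g : ℕ → H} {m : H}
    (h : ∀ᶠ n in Filter.atTop, rangeProd g n = m) : limProd g = m := by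
  have h' : ∃ m, ∀ᶠ n in Filter.atTop, rangeProd g n = m := ⟨m, h⟩
  rw [limProd, dif_pos h']
  obtain ⟨n, hn1, hn2⟩ := (h.and h'.choose_spec).exists
  rw [← hn1, ← hn2]

theorem limProd_eq_rangeProd {H : Type*} [Monoid H] {g : ℕ → H} {n : ℕ}
    (h : ∀ i, n ≤ i → g i = 1) : limProd g = rangeProd g n := by
  refine limProd_eq (Filter.eventually_atTop.2 ⟨n, fun k hk => ?_⟩)
  obtain ⟨l, rfl⟩ := Nat.exists_eq_add_of_le hk
  rw [rangeProd_add, rangeProd_eq_one (g := fun i => g (n + i)) fun i _ => h _ (by omega), mul_one]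

theorem eventually_rangeProd_eq_limProd {H : Type*} [Monoid H] {g : ℕ → H}
    (h : ∀ᶠ i in Filter.atTop, g i = 1) :
    ∀ᶠ n in Filter.atTop, rangeProd g n = limProd g := by
  obtain ⟨n, hn⟩ := Filter.eventually_atTop.1 h
  refine Filter.eventually_atTop.2 ⟨n, fun k hk => ?_⟩
  exact (limProd_eq_rangeProd fun i hi => hn i (hk.trans hi)).symm

theorem limProd_congr {H : Type*} [Monoid H] {g h : ℕ → H}
    (hgh : ∀ i, g i = h i) : limProd g = limProd h := by
  rw [funext hgh]

theorem limProd_eq_one {H : Type*} [Monoid H] {g : ℕ → H} (hg : ∀ i, g i = 1) :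
    limProd g = 1 := by
  rw [limProd_eq_rangeProd (n := 0) fun i _ => hg i, rangeProd_zero]

theorem limProd_eq_of_forall_ne {H : Type*} [Monoid H] {g : ℕ → H} (z : ℕ)
    (hg : ∀ i, i ≠ z → g i = 1) : limProd g = g z := by
  rw [limProd_eq_rangeProd (n := z + 1) fun i hi => hg i (by omega), rangeProd_succ,
    rangeProd_eq_one fun i hi => hg i (by omega), one_mul]

end Products

/-! ### Substitution in terms. -/

namespace Term

/-- Replace the variables by the terms `p` and apply `κ` to the constants. -/
def bind {n m : ℕ} (κ : ℕ → ℕ) (p : Fin n → Term m) : Term n → Term m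
  | .var i => p i
  | .const c => .const (κ c)
  | .add σ τ => .add (σ.bind κ p) (τ.bind κ p)

/-- Shift all variables by one. -/
def shift {n : ℕ} (σ : Term n) : Term (n + 1) :=
  σ.bind id fun i => .var i.succ

/-- The term `k σ`. -/
def smul {n : ℕ} : ℕ → Term n → Term n
  | 0, _ => .const 0
  | k + 1, σ => .add (smul k σ) σ

@[simp] theorem eval_var {n : ℕ} (i : Fin n) (v : Fin n → ℕ) : (Term.var i).eval v = v i := rfl
@[simp] theorem eval_const {n : ℕ} (c : ℕ) (v : Fin n → ℕ) : (Term.const c).eval v = c := rfl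
@[simp] theorem eval_add {n : ℕ} (σ τ : Term n) (v : Fin n → ℕ) :
    (Term.add σ τ).eval v = σ.eval v + τ.eval v := rfl

@[simp] theorem eval_smul {n : ℕ} (k : ℕ) (σ : Term n) (v : Fin n → ℕ) :
    (smul k σ).eval v = k * σ.eval v := by
  induction k with
  | zero => simp [smul]
  | succ k ih => simp [smul, ih]; ring

@[simp] theorem eval_shift_cons {n : ℕ} (σ : Term n) (y : ℕ) (v : Fin n → ℕ) :
    σ.shift.eval (Fin.cons y v : Fin (n + 1) → ℕ) = σ.eval v := by
  induction σ with
  | var i => simp [shift, bind]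
  | const c => simp [shift, bind]
  | add σ τ h1 h2 => simp only [shift] at h1 h2; simp [shift, bind, h1, h2]

/-- This clears denominators in the substitution `v i = (p i - q i) / α` without subtraction.
Constants are scaled by `α` on the `p` side and dropped on the `q` side, so that they are counted
once. -/
theorem eval_bind {n m : ℕ} {α : ℕ} {p q : Fin n → Term m} {u : Fin m → ℕ} {v : Fin n → ℕ}
    (h : ∀ i, α * v i + (q i).eval u = (p i).eval u) (σ : Term n) :
    α * σ.eval v + (σ.bind (fun _ => 0) q).eval u = (σ.bind (fun c => α * c) p).eval u := by
  induction σ with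
  | var i => simpa [bind] using h i
  | const c => simp [bind]
  | add σ τ h1 h2 => simp only [bind, eval_add, ← h1, ← h2]; ring

end Term

/-! ### The choice of a monoid element by a list of conditions. -/

namespace FinMonoid

theorem finite_carrier (M : FinMonoid) : Finite M.carrier := by
  have h1 : {a : M.carrier | a ≠ 1}.Finite := Set.finite_coe_iff.1 (Finite.of_equiv _ M.enum)
  refine Set.finite_univ_iff.1 ((h1.union (Set.finite_singleton 1)).subset fun a _ => ?_)
  by_cases h : a = 1
  exacts [Or.inr h, Or.inl h]

theorem pick_eq_one {M : FinMonoid} {P : Fin M.K → Prop} (h : ∀ j, ¬ P j) : M.pick P = 1 := by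
  unfold pick
  split
  · rename_i j hj
    exact absurd (by simpa using List.find?_some hj) (h j)
  · rfl

theorem exists_pick_eq {M : FinMonoid} {P : Fin M.K → Prop} {j : Fin M.K} (h : P j) :
    ∃ j, P j ∧ M.pick P = (M.enum j).1 := by
  unfold pick
  split
  · rename_i i hi
    exact ⟨i, by simpa using List.find?_some hi, rfl⟩
  · rename_i hj
    simp only [List.find?_eq_none, decide_eq_true_eq] at hj
    exact absurd h (hj j (List.mem_finRange j))

theorem pick_congr {M : FinMonoid} {P Q : Fin M.K → Prop} (h : ∀ j, P j ↔ Q j) :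
    M.pick P = M.pick Q := by
  rw [funext fun j => propext (h j)]

/-- Any monoid-valued function can thus be fed to a quantifier: its `j`-th formula says that the
value is `m_j`, and the value `1` is the default. -/
theorem pick_eq_enum (M : FinMonoid) (a : M.carrier) : M.pick (fun j => (M.enum j).1 = a) = a := by
  by_cases h : a = 1
  · rw [pick_eq_one fun j hj => (M.enum j).2 (hj.trans h), h]
  · obtain ⟨j, h1, h2⟩ := exists_pick_eq (P := fun j => (M.enum j).1 = a)
      (j := M.enum.symm ⟨a, h⟩) (by simp)
    rw [h2, h1]

end FinMonoid

/-! ### Sets and functions definable on sparse words. -/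

/-- `w` is a word in `A^* lam^ω` with `nnp w ⊆ D_r` for some `r ≥ R`. -/
def Sparse {A : Type*} (lam : A) (R : ℕ) (w : ℕ → A) : Prop :=
  (nnp lam w).Finite ∧ ∃ r, R ≤ r ∧ nnp lam w ⊆ powers r

theorem Sparse.mono {A : Type*} {lam : A} {R R' : ℕ} {w : ℕ → A} (h : Sparse lam R w)
    (hR : R' ≤ R) : Sparse lam R' w :=
  ⟨h.1, h.2.imp fun _ hr => ⟨hR.trans hr.1, hr.2⟩⟩

/-- `P` is defined on sparse words by an active domain formula with quantifiers from `𝓜`. -/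
def Definable {A : Type*} (lam : A) (𝓜 : Set FinMonoid) {n : ℕ}
    (P : (ℕ → A) → (Fin n → ℕ) → Prop) : Prop :=
  ∃ ψ : Formula A n, ψ.IsActiveDomain lam ∧ ψ.monoids ⊆ 𝓜 ∧
    ∃ R, ∀ w, Sparse lam R w → ∀ v, P w v ↔ ψ.Sat w v

/-- The function `E` takes each value on a definable set. -/
def DefinableFun {A : Type*} (lam : A) (𝓜 : Set FinMonoid) {n : ℕ} {H : Type*}
    (E : (ℕ → A) → (Fin n → ℕ) → H) : Prop :=
  ∀ g, Definable lam 𝓜 fun w v => E w v = g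

section Closure

variable {A : Type*} {lam : A} {𝓜 : Set FinMonoid} {n : ℕ}

theorem Definable.congr {P Q : (ℕ → A) → (Fin n → ℕ) → Prop} (hP : Definable lam 𝓜 P) (R : ℕ)
    (h : ∀ w, Sparse lam R w → ∀ v, Q w v ↔ P w v) : Definable lam 𝓜 Q := by
  obtain ⟨ψ, h1, h2, R', h3⟩ := hP
  exact ⟨ψ, h1, h2, max R R', fun w hw v =>
    (h w (hw.mono (le_max_left _ _)) v).trans (h3 w (hw.mono (le_max_right _ _)) v)⟩

theorem Definable.congr' {P Q : (ℕ → A) → (Fin n → ℕ) → Prop} (hP : Definable lam 𝓜 P)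
    (h : ∀ w v, Q w v ↔ P w v) : Definable lam 𝓜 Q :=
  hP.congr 0 fun w _ => h w

theorem definable_sat {ψ : Formula A n} (h1 : ψ.IsActiveDomain lam) (h2 : ψ.monoids ⊆ 𝓜) :
    Definable lam 𝓜 fun w v => ψ.Sat w v :=
  ⟨ψ, h1, h2, 0, fun _ _ _ => Iff.rfl⟩

theorem definable_eq (σ τ : Term n) :
    Definable lam 𝓜 fun _ v => σ.eval v = τ.eval v :=
  definable_sat (.eq σ τ) (Set.empty_subset _)

theorem definable_lt (σ τ : Term n) :
    Definable lam 𝓜 fun _ v => σ.eval v < τ.eval v :=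
  definable_sat (.lt σ τ) (Set.empty_subset _)

theorem Definable.not {P : (ℕ → A) → (Fin n → ℕ) → Prop} (hP : Definable lam 𝓜 P) :
    Definable lam 𝓜 fun w v => ¬ P w v := by
  obtain ⟨ψ, h1, h2, R, h3⟩ := hP
  exact ⟨ψ.neg, h1.neg, h2, R, fun w hw v => not_congr (h3 w hw v)⟩

theorem Definable.and {P Q : (ℕ → A) → (Fin n → ℕ) → Prop} (hP : Definable lam 𝓜 P)
    (hQ : Definable lam 𝓜 Q) : Definable lam 𝓜 fun w v => P w v ∧ Q w v := by
  obtain ⟨ψ, h1, h2, R, h3⟩ := hP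
  obtain ⟨ψ', h1', h2', R', h3'⟩ := hQ
  exact ⟨ψ.and ψ', h1.and h1', Set.union_subset h2 h2', max R R', fun w hw v =>
    and_congr (h3 w (hw.mono (le_max_left _ _)) v) (h3' w (hw.mono (le_max_right _ _)) v)⟩

theorem Definable.or {P Q : (ℕ → A) → (Fin n → ℕ) → Prop} (hP : Definable lam 𝓜 P)
    (hQ : Definable lam 𝓜 Q) : Definable lam 𝓜 fun w v => P w v ∨ Q w v :=
  (hP.not.and hQ.not).not.congr' fun w v => by tauto

theorem definable_const (p : Prop) :
    Definable lam 𝓜 fun (_ : ℕ → A) (_ : Fin n → ℕ) => p := by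
  by_cases hp : p
  · exact (definable_eq (.const 0) (.const 0)).congr' fun w v => by simp [hp]
  · exact (definable_eq (.const 0) (.const 1)).congr' fun w v => by simp [hp]

theorem Definable.imp {P Q : (ℕ → A) → (Fin n → ℕ) → Prop} (hP : Definable lam 𝓜 P)
    (hQ : Definable lam 𝓜 Q) : Definable lam 𝓜 fun w v => P w v → Q w v :=
  (hP.not.or hQ).congr' fun w v => by tauto

theorem Definable.iff {P Q : (ℕ → A) → (Fin n → ℕ) → Prop} (hP : Definable lam 𝓜 P)
    (hQ : Definable lam 𝓜 Q) : Definable lam 𝓜 fun w v => (P w v ↔ Q w v) :=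
  ((hP.imp hQ).and (hQ.imp hP)).congr' fun w v => by tauto

theorem definable_modEq {q : ℕ} (hq : 0 < q) (σ τ : Term n) :
    Definable lam 𝓜 fun _ v => σ.eval v ≡ τ.eval v [MOD q] := by
  obtain rfl | hq := (show q = 1 ∨ 1 < q by omega)
  · exact (definable_const True).congr' fun w v => by simp [Nat.modEq_one]
  · exact definable_sat (.modEq q hq σ τ) (Set.empty_subset _)

theorem Definable.exists_mem {ι : Type*} {P : ι → (ℕ → A) → (Fin n → ℕ) → Prop} (s : Finset ι)
    (hP : ∀ i ∈ s, Definable lam 𝓜 (P i)) : Definable lam 𝓜 fun w v => ∃ i ∈ s, P i w v := by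
  classical
  induction s using Finset.induction_on with
  | empty => exact (definable_const False).congr' fun w v => by simp
  | insert a s ha ih =>
    refine ((hP a (by simp)).or (ih fun i hi => hP i (by simp [hi]))).congr' fun w v => ?_
    simp

theorem Definable.exists {ι : Type*} [Finite ι] {P : ι → (ℕ → A) → (Fin n → ℕ) → Prop}
    (hP : ∀ i, Definable lam 𝓜 (P i)) : Definable lam 𝓜 fun w v => ∃ i, P i w v := by
  have := Fintype.ofFinite ι
  exact (Definable.exists_mem Finset.univ fun i _ => hP i).congr' fun w v => by simp

theorem Definable.forall {ι : Type*} [Finite ι] {P : ι → (ℕ → A) → (Fin n → ℕ) → Prop}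
    (hP : ∀ i, Definable lam 𝓜 (P i)) : Definable lam 𝓜 fun w v => ∀ i, P i w v :=
  (Definable.exists fun i => (hP i).not).not.congr' fun w v => by simp

protected theorem DefinableFun.congr {H : Type*} {E F : (ℕ → A) → (Fin n → ℕ) → H}
    (hE : DefinableFun lam 𝓜 E) (R : ℕ) (h : ∀ w, Sparse lam R w → ∀ v, F w v = E w v) :
    DefinableFun lam 𝓜 F :=
  fun g => (hE g).congr R fun w hw v => by rw [h w hw v]

theorem definableFun_const {H : Type*} (g : H) :
    DefinableFun lam 𝓜 fun (_ : ℕ → A) (_ : Fin n → ℕ) => g :=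
  fun g' => definable_const (g = g')

protected theorem DefinableFun.comp {H H' : Type*} [Finite H] {E : (ℕ → A) → (Fin n → ℕ) → H}
    (hE : DefinableFun lam 𝓜 E) (f : H → H') : DefinableFun lam 𝓜 fun w v => f (E w v) :=
  fun g => (Definable.exists fun h : H => (hE h).and (definable_const (f h = g))).congr'
    fun w v => by simp

theorem DefinableFun.comp₂ {H H' H'' : Type*} [Finite H] [Finite H']
    {E : (ℕ → A) → (Fin n → ℕ) → H} {F : (ℕ → A) → (Fin n → ℕ) → H'}
    (hE : DefinableFun lam 𝓜 E) (hF : DefinableFun lam 𝓜 F) (f : H → H' → H'') :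
    DefinableFun lam 𝓜 fun w v => f (E w v) (F w v) :=
  fun g => (Definable.exists fun h : H × H' => ((hE h.1).and (hF h.2)).and
    (definable_const (f h.1 h.2 = g))).congr' fun w v => by simp

open Classical in
protected theorem DefinableFun.ite {H : Type*} {P : (ℕ → A) → (Fin n → ℕ) → Prop}
    {E F : (ℕ → A) → (Fin n → ℕ) → H} (hP : Definable lam 𝓜 P) (hE : DefinableFun lam 𝓜 E)
    (hF : DefinableFun lam 𝓜 F) :
    DefinableFun lam 𝓜 fun w v => if P w v then E w v else F w v :=
  fun g => ((hP.and (hE g)).or (hP.not.and (hF g))).congr' fun w v => by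
    by_cases h : P w v <;> simp [h]

protected theorem DefinableFun.rangeProd {H : Type*} [Finite H] [Monoid H]
    {E : ℕ → (ℕ → A) → (Fin n → ℕ) → H} (hE : ∀ i, DefinableFun lam 𝓜 (E i)) (k : ℕ) :
    DefinableFun lam 𝓜 fun w v => rangeProd (fun i => E i w v) k := by
  induction k with
  | zero => simpa using definableFun_const (1 : H)
  | succ k ih => simpa only [rangeProd_succ] using ih.comp₂ (hE k) fun a b => a * b

protected theorem DefinableFun.pick {M : FinMonoid} {P : Fin M.K → (ℕ → A) → (Fin n → ℕ) → Prop}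
    (hP : ∀ j, Definable lam 𝓜 (P j)) :
    DefinableFun lam 𝓜 fun w v => M.pick fun j => P j w v :=
  fun g => (Definable.exists fun s : Set (Fin M.K) =>
    (Definable.forall fun j => (hP j).iff (definable_const (j ∈ s))).and
      (definable_const (M.pick (fun j => j ∈ s) = g))).congr' fun w v => by
    constructor
    · exact fun h => ⟨{j | P j w v}, fun j => Iff.rfl, h⟩
    · rintro ⟨s, h1, h2⟩
      exact (FinMonoid.pick_congr h1).trans h2

-- Here a product turns into a quantifier of `G`: the guard `¬ lam(y)` makes the factors at inactive
-- positions `1`. Finiteness of `nnp lam w` makes the product stabilise, so that its eventual value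
-- is the one the quantifier tests.
open Classical in
theorem DefinableFun.limProd_nnp {G : FinMonoid} (hG : G ∈ 𝓜)
    {E : (ℕ → A) → (Fin (n + 1) → ℕ) → G.carrier} (hE : DefinableFun lam 𝓜 E) :
    DefinableFun lam 𝓜 fun w (v : Fin n → ℕ) =>
      limProd fun y => if y ∈ nnp lam w then E w (Fin.cons y v : Fin (n + 1) → ℕ) else 1 := by
  intro g
  choose ψ h1 h2 R h3 using fun j => hE (G.enum j).1
  refine ⟨.quant G g fun j => .and (.neg (.letter lam (.var 0))) (ψ j), .quant G g h1, ?_,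
    Finset.univ.sup R, fun w hw v => ?_⟩
  · simp only [Formula.monoids, Set.union_subset_iff, Set.singleton_subset_iff,
      Set.iUnion_subset_iff]
    exact ⟨hG, fun j => ⟨Set.empty_subset _, h2 j⟩⟩
  · have key : ∀ y, (G.pick fun j => (Formula.and (.neg (.letter lam (.var 0))) (ψ j)).Sat w
        (Fin.cons y v : Fin (n + 1) → ℕ)) =
        if y ∈ nnp lam w then E w (Fin.cons y v : Fin (n + 1) → ℕ) else 1 := by
      intro y
      split_ifs with hy
      · rw [← G.pick_eq_enum (E w _)]
        refine FinMonoid.pick_congr fun j => ?_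
        have hj := h3 j w (hw.mono (Finset.le_sup (Finset.mem_univ j)))
          (Fin.cons y v : Fin (n + 1) → ℕ)
        rw [eq_comm]
        exact (and_iff_right hy).trans hj.symm
      · refine FinMonoid.pick_eq_one fun j hj => hy ?_
        exact hj.1
    simp only [Formula.Sat] at key ⊢
    simp only [key]
    have hev : ∀ᶠ k in Filter.atTop, rangeProd (fun y => if y ∈ nnp lam w then
        E w (Fin.cons y v : Fin (n + 1) → ℕ) else 1) k = limProd fun y => if y ∈ nnp lam w then
        E w (Fin.cons y v : Fin (n + 1) → ℕ) else 1 := by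
      apply eventually_rangeProd_eq_limProd
      obtain ⟨b, hb⟩ := hw.1.bddAbove
      refine Filter.eventually_atTop.2 ⟨b + 1, fun i hi => if_neg fun h => ?_⟩
      have := hb h
      omega
    constructor
    · rintro rfl
      exact hev
    · exact limProd_eq

end Closure

/-! ### Substitution of rational linear forms in active domain formulas. -/

section Substitution

variable {A : Type*} {lam : A} {𝓜 : Set FinMonoid} {G : FinMonoid}

/-- Substitution of rational linear forms `(p i - q i) / α` for the variables of a formula. -/
theorem Formula.IsActiveDomain.exists_subst (hG : G ∈ 𝓜) (hK : 0 < G.K) {n : ℕ}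
    {θ : Formula A n} (hθ : θ.IsActiveDomain lam) (hm : θ.monoids ⊆ 𝓜) {m : ℕ} {α : ℕ}
    (hα : 0 < α) (p q : Fin n → Term m) :
    ∃ ψ : Formula A m, ψ.IsActiveDomain lam ∧ ψ.monoids ⊆ 𝓜 ∧ ∀ w u v,
      (∀ i, α * v i + (q i).eval u = (p i).eval u) → (ψ.Sat w u ↔ θ.Sat w v) := by
  induction hθ generalizing m with
  | @letter n c σ =>
    -- `y ∈ nnp w` with `y = σ` and `χ y`
    have key : ∀ χ : Formula A (m + 1), χ.IsActiveDomain lam → χ.monoids = ∅ →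
        ∃ ψ : Formula A m, ψ.IsActiveDomain lam ∧ ψ.monoids ⊆ 𝓜 ∧ ∀ w u v,
          (∀ i, α * v i + (q i).eval u = (p i).eval u) → (ψ.Sat w u ↔
            w (σ.eval v) ≠ lam ∧ χ.Sat w (Fin.cons (σ.eval v) u : Fin (m + 1) → ℕ)) := by
      intro χ hχ hχm
      -- The position `σ` has become a quotient and need not be a term of the new variables. A
      -- quantifier of `G` searches for it among the active positions. Only the formula of index `0`
      -- can hold, and only at that position, so the product is `G.enum ⟨0, hK⟩` or `1`; this uses
      -- that `G` is nontrivial.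
      refine ⟨.quant G (G.enum ⟨0, hK⟩).1 fun j => .and (.neg (.letter lam (.var 0)))
        (.and (.and (.eq (.const j) (.const 0)) (.eq (.add (.smul α (.var 0)) (σ.bind (fun _ => 0) q).shift)
          (σ.bind (fun c => α * c) p).shift)) χ), .quant G _ fun _ => .and (.and (.eq _ _) (.eq _ _)) hχ,
        ?_, ?_⟩
      · simp [Formula.monoids, hχm, hG]
      · intro w u v h
        have hev : ∀ y, α * y + (σ.bind (fun _ => 0) q).eval u =
            (σ.bind (fun c => α * c) p).eval u ↔ y = σ.eval v := by
          intro y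
          rw [← Term.eval_bind h]
          simp [hα.ne']
        have h0 : ((G.enum ⟨0, hK⟩).1 : G.carrier) ≠ 1 := (G.enum ⟨0, hK⟩).2
        simp only [Formula.Sat, Term.eval_add, Term.eval_smul, Term.eval_var, Fin.cons_zero,
          Term.eval_shift_cons, Term.eval_const, hev]
        set g : ℕ → G.carrier := fun i => G.pick fun j => ¬ w i = lam ∧ (j.1 = 0 ∧ i = σ.eval v) ∧
          χ.Sat w (Fin.cons i u : Fin (m + 1) → ℕ) with hg
        have hg1 : ∀ i, i ≠ σ.eval v → g i = 1 := fun i hi =>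
          FinMonoid.pick_eq_one fun _ hj => hi hj.2.1.2
        have hlim : ∀ᶠ k in Filter.atTop, rangeProd g k = limProd g :=
          eventually_rangeProd_eq_limProd (Filter.eventually_atTop.2
            ⟨σ.eval v + 1, fun i hi => hg1 i (by omega)⟩)
        have hiff : (∀ᶠ k in Filter.atTop, rangeProd g k = (G.enum ⟨0, hK⟩).1) ↔
            g (σ.eval v) = (G.enum ⟨0, hK⟩).1 := by
          rw [← limProd_eq_of_forall_ne _ hg1]
          exact ⟨limProd_eq, fun h => h ▸ hlim⟩
        refine hiff.trans ⟨fun h => ?_, fun h => ?_⟩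
        · by_contra hcon
          exact h0 (h.symm.trans (FinMonoid.pick_eq_one fun _ hj => hcon ⟨hj.1, hj.2.2⟩))
        · rw [hg, ← G.pick_eq_enum (G.enum ⟨0, hK⟩).1]
          refine FinMonoid.pick_congr fun j => ?_
          rw [Subtype.val_inj, G.enum.apply_eq_iff_eq, Fin.ext_iff]
          exact ⟨fun hj => hj.2.1.1, fun hj => ⟨h.1, ⟨hj, rfl⟩, h.2⟩⟩
    -- The search sees active positions only, so the letter `lam` is expressed as its failure.
    by_cases hc : c = lam
    · obtain ⟨ψ, h1, h2, h3⟩ := key (.eq (.const 0) (.const 0)) (.eq _ _) rfl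
      refine ⟨ψ.neg, h1.neg, h2, fun w u v h => ?_⟩
      simp [Formula.Sat, h3 w u v h, hc]
    · obtain ⟨ψ, h1, h2, h3⟩ := key (.letter c (.var 0)) (.letter _ _) rfl
      refine ⟨ψ, h1, h2, fun w u v h => ?_⟩
      simp only [Formula.Sat, h3 w u v h, Term.eval_var, Fin.cons_zero, and_iff_right_iff_imp]
      rintro rfl
      exact hc
  | eq σ τ =>
    refine ⟨.eq (.add (σ.bind (fun c => α * c) p) (τ.bind (fun _ => 0) q))
      (.add (τ.bind (fun c => α * c) p) (σ.bind (fun _ => 0) q)), .eq _ _, Set.empty_subset _,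
      fun w u v h => ?_⟩
    simp only [Formula.Sat, Term.eval_add, ← Term.eval_bind h]
    rw [← Nat.mul_right_inj hα.ne' (b := σ.eval v)]
    omega
  | lt σ τ =>
    refine ⟨.lt (.add (σ.bind (fun c => α * c) p) (τ.bind (fun _ => 0) q))
      (.add (τ.bind (fun c => α * c) p) (σ.bind (fun _ => 0) q)), .lt _ _, Set.empty_subset _,
      fun w u v h => ?_⟩
    simp only [Formula.Sat, Term.eval_add, ← Term.eval_bind h]
    rw [← Nat.mul_lt_mul_left hα (b := σ.eval v)]
    omega
  | modEq k hk σ τ =>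
    -- Both sides are scaled by `α`, so the modulus is scaled too.
    refine ⟨.modEq (α * k) (by nlinarith)
      (.add (σ.bind (fun c => α * c) p) (τ.bind (fun _ => 0) q))
      (.add (τ.bind (fun c => α * c) p) (σ.bind (fun _ => 0) q)), .modEq _ _ _ _,
      Set.empty_subset _, fun w u v h => ?_⟩
    simp only [Formula.Sat, Term.eval_add, ← Term.eval_bind h]
    rw [add_assoc, add_assoc, add_comm (Term.eval (τ.bind _ q) u) (Term.eval (σ.bind _ q) u)]
    refine ⟨fun h => Nat.ModEq.mul_left_cancel' hα.ne' (Nat.ModEq.add_right_cancel' _ h),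
      fun h => (Nat.ModEq.mul_left' α h).add_right _⟩
  | neg _ ih =>
    obtain ⟨ψ, h1, h2, h3⟩ := ih hm p q
    exact ⟨ψ.neg, h1.neg, h2, fun w u v h => not_congr (h3 w u v h)⟩
  | and _ _ ih ih' =>
    obtain ⟨ψ, h1, h2, h3⟩ := ih (Set.union_subset_iff.1 hm).1 p q
    obtain ⟨ψ', h1', h2', h3'⟩ := ih' (Set.union_subset_iff.1 hm).2 p q
    exact ⟨ψ.and ψ', h1.and h1', Set.union_subset h2 h2',
      fun w u v h => and_congr (h3 w u v h) (h3' w u v h)⟩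
  | or _ _ ih ih' =>
    obtain ⟨ψ, h1, h2, h3⟩ := ih (Set.union_subset_iff.1 hm).1 p q
    obtain ⟨ψ', h1', h2', h3'⟩ := ih' (Set.union_subset_iff.1 hm).2 p q
    exact ⟨ψ.or ψ', h1.or h1', Set.union_subset h2 h2',
      fun w u v h => or_congr (h3 w u v h) (h3' w u v h)⟩
  | @quant n M g φ _ ih =>
    simp only [Formula.monoids, Set.union_subset_iff, Set.singleton_subset_iff,
      Set.iUnion_subset_iff] at hm
    -- The bound variable `y` is kept, written as the quotient `(α y - 0) / α`.
    choose ψ h1 h2 h3 using fun j => ih j (hm.2 j).2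
      (Fin.cons (.smul α (.var 0)) fun i => (p i).shift : Fin (n + 1) → Term (m + 1))
      (Fin.cons (.const 0) fun i => (q i).shift : Fin (n + 1) → Term (m + 1))
    refine ⟨.quant M g fun j => .and (.neg (.letter lam (.var 0))) (ψ j), .quant M g h1, ?_,
      fun w u v h => ?_⟩
    · simp only [Formula.monoids, Set.union_subset_iff, Set.singleton_subset_iff,
        Set.iUnion_subset_iff]
      exact ⟨hm.1, fun j => ⟨Set.empty_subset _, h2 j⟩⟩
    · simp only [Formula.Sat, Term.eval_var, Fin.cons_zero]
      have : ∀ i j, (ψ j).Sat w (Fin.cons i u : Fin (m + 1) → ℕ) ↔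
          (φ j).Sat w (Fin.cons i v : Fin (n + 1) → ℕ) := by
        intro i j
        refine h3 j w _ _ (Fin.cases (by simp) fun l => ?_)
        simpa using h l
      simp only [this]

/-- Substitution of rational linear forms `(p i - q i) / α` for the variables. -/
theorem Definable.subst (hG : G ∈ 𝓜) (hK : 0 < G.K) {n m : ℕ}
    {P : (ℕ → A) → (Fin n → ℕ) → Prop} (hP : Definable lam 𝓜 P) {α : ℕ}
    (hα : 0 < α) (p q : Fin n → Term m) :
    Definable lam 𝓜 fun w u => ∃ v, (∀ i, α * v i + (q i).eval u = (p i).eval u) ∧ P w v := by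
  obtain ⟨θ, h1, h2, R, h3⟩ := hP
  obtain ⟨ψ, h1', h2', h3'⟩ := h1.exists_subst hG hK h2 hα p q
  -- The quotients are natural numbers exactly when `q i ≡ p i` modulo `α` and `q i ≤ p i`.
  refine ((definable_sat h1' h2').and (Definable.forall fun i =>
    (definable_modEq hα (q i) (p i)).and (definable_lt (p i) (q i)).not)).congr R
      fun w hw u => ?_
  constructor
  · rintro ⟨v, hv, hPv⟩
    refine ⟨(h3' w u v hv).2 ((h3 w hw v).1 hPv), fun i => ⟨?_, ?_⟩⟩
    · rw [← hv i, Nat.ModEq.comm]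
      simp [Nat.ModEq]
    · rw [← hv i]
      omega
  · rintro ⟨h, hv⟩
    choose v hv' using fun i => (Nat.modEq_iff_dvd' (not_lt.1 (hv i).2)).1 (hv i).1
    have hv'' : ∀ i, α * v i + (q i).eval u = (p i).eval u := by
      intro i
      have := (hv i).2
      have := hv' i
      omega
    exact ⟨v, hv'', (h3 w hw v).2 ((h3' w u v hv'').1 h)⟩

theorem Definable.comp_term (hG : G ∈ 𝓜) (hK : 0 < G.K) {n m : ℕ}
    {P : (ℕ → A) → (Fin n → ℕ) → Prop} (hP : Definable lam 𝓜 P) (p : Fin n → Term m) :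
    Definable lam 𝓜 fun w u => P w fun i => (p i).eval u :=
  (hP.subst hG hK one_pos p fun _ => .const 0).congr' fun w u => by
    constructor
    · exact fun h => ⟨_, fun i => by simp, h⟩
    · rintro ⟨v, hv, h⟩
      rwa [show (fun i => (p i).eval u) = v from funext fun i => by simpa using (hv i).symm]

end Substitution

/-! ### Eventual products over ordered families of blocks. -/

section Products

theorem eventually_eq_one_of_finite {H : Type*} [Monoid H] {g : ℕ → H} {S : Set ℕ}
    (hS : S.Finite) (hg : ∀ i ∉ S, g i = 1) : ∀ᶠ i in Filter.atTop, g i = 1 := by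
  obtain ⟨b, hb⟩ := hS.bddAbove
  refine Filter.eventually_atTop.2 ⟨b + 1, fun i hi => hg i fun h => ?_⟩
  have := hb h
  omega

open Classical in
theorem limProd_biUnion {H : Type*} [Monoid H] (g : ℕ → H) {D : Set ℕ} (hD : D.Finite)
    {B : ℕ → Set ℕ} (hfin : ∀ y ∈ D, (B y).Finite)
    (hB : ∀ y ∈ D, ∀ y' ∈ D, y < y' → ∀ z ∈ B y, ∀ z' ∈ B y', z < z') :
    limProd (fun z => if ∃ y ∈ D, z ∈ B y then g z else 1) =
      limProd (fun y => if y ∈ D then limProd (fun z => if z ∈ B y then g z else 1) else 1) := by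
  obtain ⟨k, hk⟩ := hD.bddAbove
  obtain ⟨n, hn⟩ := (hD.biUnion hfin).bddAbove
  have hn' : ∀ y ∈ D, ∀ z ∈ B y, z < n + 1 := fun y hy z hz =>
    Nat.lt_succ_of_le (hn (Set.mem_biUnion hy hz))
  have hk' : ∀ y ∈ D, y < k + 1 := fun y hy => Nat.lt_succ_of_le (hk hy)
  rw [limProd_eq_rangeProd (n := n + 1) fun z hz => if_neg ?_,
    limProd_eq_rangeProd (n := k + 1) fun y hy => if_neg ?_]
  · convert rangeProd_biUnion g hB (n + 1) (k + 1) using 1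
    · refine rangeProd_congr fun z _ => if_congr ?_ rfl rfl
      exact exists_congr fun y => and_congr_right fun hy => (and_iff_right (hk' y hy)).symm
    · refine rangeProd_congr fun y _ => ?_
      by_cases hy : y ∈ D
      · rw [if_pos hy, if_pos hy, limProd_eq_rangeProd fun z hz => if_neg fun h => ?_]
        exact absurd (hn' y hy z h) (by omega)
      · rw [if_neg hy, if_neg hy]
  · intro h
    exact absurd (hk' y h) (by omega)
  · rintro ⟨y, hy, h⟩
    exact absurd (hn' y hy z h) (by omega)

open Classical in
theorem limProd_biUnion_of_gt {H : Type*} [Group H] (g : ℕ → H) {D : Set ℕ} (hD : D.Finite)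
    {B : ℕ → Set ℕ} (hfin : ∀ y ∈ D, (B y).Finite)
    (hB : ∀ y ∈ D, ∀ y' ∈ D, y < y' → ∀ z ∈ B y, ∀ z' ∈ B y', z' < z) :
    limProd (fun z => if ∃ y ∈ D, z ∈ B y then g z else 1) =
      (limProd (fun y => if y ∈ D then
        (limProd (fun z => if z ∈ B y then g z else 1))⁻¹ else 1))⁻¹ := by
  obtain ⟨k, hk⟩ := hD.bddAbove
  obtain ⟨n, hn⟩ := (hD.biUnion hfin).bddAbove
  have hn' : ∀ y ∈ D, ∀ z ∈ B y, z < n + 1 := fun y hy z hz =>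
    Nat.lt_succ_of_le (hn (Set.mem_biUnion hy hz))
  have hk' : ∀ y ∈ D, y < k + 1 := fun y hy => Nat.lt_succ_of_le (hk hy)
  rw [limProd_eq_rangeProd (n := n + 1) fun z hz => if_neg ?_,
    limProd_eq_rangeProd (n := k + 1) fun y hy => if_neg ?_]
  · convert rangeProd_biUnion_of_gt g hB (n + 1) (k + 1) using 1
    · refine rangeProd_congr fun z _ => if_congr ?_ rfl rfl
      exact exists_congr fun y => and_congr_right fun hy => (and_iff_right (hk' y hy)).symm
    · refine congrArg _ (rangeProd_congr fun y _ => ?_)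
      by_cases hy : y ∈ D
      · rw [if_pos hy, if_pos hy, limProd_eq_rangeProd fun z hz => if_neg fun h => ?_]
        exact absurd (hn' y hy z h) (by omega)
      · rw [if_neg hy, if_neg hy]
  · intro h
    exact absurd (hk' y h) (by omega)
  · rintro ⟨y, hy, h⟩
    exact absurd (hn' y hy z h) (by omega)

end Products

/-! ### Sums over decreasing chains of powers of `r`. -/

section ChainSums

/-- The sums `∑ β_i y_i` with `y_1 > y_2 > ⋯` in `D`, all of them below `M` if `M` is given. -/
def chainSums (D : Set ℕ) : List ℤ → Option ℕ → Set ℤ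
  | [], _ => {0}
  | β :: βs, M => {x | ∃ y ∈ D, (∀ b ∈ M, y < b) ∧ ∃ v ∈ chainSums D βs (some y), x = β * y + v}

theorem finite_chainSums {D : Set ℕ} (hD : D.Finite) (βs : List ℤ) (M : Option ℕ) :
    (chainSums D βs M).Finite := by
  induction βs generalizing M with
  | nil => exact Set.finite_singleton 0
  | cons β βs ih =>
    refine (hD.biUnion fun y _ => (ih (some y)).image fun v => β * y + v).subset ?_
    rintro x ⟨y, hy, -, v, hv, rfl⟩
    exact Set.mem_biUnion hy ⟨v, hv, rfl⟩

theorem mul_le_of_mem_powers {r d d' : ℕ} (hr : 0 < r) (hd : d ∈ powers r) (hd' : d' ∈ powers r)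
    (h : d < d') : r * d ≤ d' := by
  obtain ⟨i, -, rfl⟩ := hd
  obtain ⟨j, -, rfl⟩ := hd'
  have hij : i < j := by
    by_contra hij
    exact absurd (Nat.pow_le_pow_right hr (not_lt.1 hij)) (by omega)
  rw [← Nat.pow_succ']
  exact Nat.pow_le_pow_right hr hij

/-- All elements of `D` below `y` are at most `y / r`, since both are powers of `r`. -/
theorem abs_le_of_mem_chainSums {D : Set ℕ} {r : ℕ} (hr : 0 < r) (hD : D ⊆ powers r)
    {βs : List ℤ} {y : ℕ} (hy : y ∈ D) {v : ℤ} (hv : v ∈ chainSums D βs (some y)) :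
    r * |v| ≤ (βs.map abs).sum * y := by
  induction βs generalizing y v with
  | nil =>
    obtain rfl : v = 0 := hv
    simp
  | cons β βs ih =>
    obtain ⟨d, hd, hdy, v', hv', rfl⟩ := hv
    have hdy' : d < y := hdy y rfl
    have h1 := ih hd hv'
    have h2 : (r * d : ℤ) ≤ y := by exact_mod_cast mul_le_of_mem_powers hr (hD hd) (hD hy) hdy'
    have h3 : 0 ≤ (βs.map abs).sum := List.sum_nonneg (by simp)
    have h4 : |β * d + v'| ≤ |β| * d + |v'| := by
      refine (abs_add_le _ _).trans ?_
      rw [abs_mul, Nat.abs_cast]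
    have h5 : (d : ℤ) ≤ y := by exact_mod_cast hdy'.le
    rw [List.map_cons, List.sum_cons, add_mul]
    calc (r : ℤ) * |β * d + v'| ≤ r * (|β| * d + |v'|) := by gcongr
      _ = |β| * (r * d) + r * |v'| := by ring
      _ ≤ |β| * y + (βs.map abs).sum * d := by gcongr
      _ ≤ |β| * y + (βs.map abs).sum * y := by gcongr

/-- With `s` the sum of the `|β_i|` over the tail, the leading terms differ by at least `y' - y ≥ (1
- 1/r) y'`, and the tails by at most `2 s y' / r`. The former is larger as soon as `r > 2 s + 1`. -/
theorem chainSums_lt {D : Set ℕ} {r : ℕ} {β : ℤ} {βs : List ℤ} (hβ : 0 < β)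
    (hr : 2 * (βs.map abs).sum + 1 < r) (hD : D ⊆ powers r) {y y' : ℕ} (hy : y ∈ D)
    (hy' : y' ∈ D) (hyy' : y < y') {v v' : ℤ} (hv : v ∈ chainSums D βs (some y))
    (hv' : v' ∈ chainSums D βs (some y')) : β * y + v < β * y' + v' := by
  have h3 : 0 ≤ (βs.map abs).sum := List.sum_nonneg (by simp)
  have hr0 : 0 < r := by omega
  have h1 := abs_le_of_mem_chainSums hr0 hD hy hv
  have h2 := abs_le_of_mem_chainSums hr0 hD hy' hv'
  have h4 : (r * y : ℤ) ≤ y' := by exact_mod_cast mul_le_of_mem_powers hr0 (hD hy) (hD hy') hyy'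
  have h5 : (y : ℤ) < y' := by exact_mod_cast hyy'
  set s := (βs.map abs).sum
  have h6 : s * (y : ℤ) ≤ s * y' := by gcongr
  have h7 : (r : ℤ) * (v - v') ≤ 2 * s * y' := by
    have : (r : ℤ) * (v - v') ≤ r * (|v| + |v'|) := by
      gcongr
      linarith [le_abs_self v, neg_abs_le v']
    linarith
  have h8 : (y' - y : ℤ) ≤ β * (y' - y) := by nlinarith
  have h9 : 2 * s * (y' : ℤ) < r * (y' - y) := by nlinarith
  have h10 : (r : ℤ) * (v - v') < r * (β * (y' - y)) := by
    have : (r : ℤ) * (y' - y) ≤ r * (β * (y' - y)) := by gcongr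
    linarith
  have := lt_of_mul_lt_mul_left h10 (by positivity)
  linarith

theorem neg_mem_chainSums {D : Set ℕ} {βs : List ℤ} {M : Option ℕ} {v : ℤ}
    (hv : v ∈ chainSums D βs M) : -v ∈ chainSums D (βs.map Neg.neg) M := by
  induction βs generalizing M v with
  | nil =>
    obtain rfl : v = 0 := hv
    exact neg_zero
  | cons β βs ih =>
    obtain ⟨y, hy, hM, v', hv', rfl⟩ := hv
    exact ⟨y, hy, hM, -v', ih hv', by ring⟩

theorem chainSums_gt {D : Set ℕ} {r : ℕ} {β : ℤ} {βs : List ℤ} (hβ : β < 0)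
    (hr : 2 * (βs.map abs).sum + 1 < r) (hD : D ⊆ powers r) {y y' : ℕ} (hy : y ∈ D)
    (hy' : y' ∈ D) (hyy' : y < y') {v v' : ℤ} (hv : v ∈ chainSums D βs (some y))
    (hv' : v' ∈ chainSums D βs (some y')) : β * y' + v' < β * y + v := by
  have := chainSums_lt (β := -β) (βs := βs.map Neg.neg) (by omega)
    (by simpa [Function.comp_def] using hr) hD hy hy' hyy' (neg_mem_chainSums hv)
    (neg_mem_chainSums hv')
  linarith

/-- The solutions `z` of `α z + q = p + v` with `v ∈ chainSums D βs M`. -/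
def chainPoints (D : Set ℕ) (α p q : ℕ) (βs : List ℤ) (M : Option ℕ) : Set ℕ :=
  {z | ∃ v ∈ chainSums D βs M, (α * z + q : ℤ) = p + v}

theorem finite_chainPoints {D : Set ℕ} (hD : D.Finite) {α : ℕ} (hα : 0 < α) (p q : ℕ)
    (βs : List ℤ) (M : Option ℕ) : (chainPoints D α p q βs M).Finite := by
  refine ((finite_chainSums hD βs M).preimage (f := fun z : ℕ => (α * z + q - p : ℤ)) ?_).subset ?_
  · intro z _ z' _ h
    simpa [hα.ne'] using h
  · rintro z ⟨v, hv, h⟩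
    simp only [Set.mem_preimage, h]
    simpa using hv

/-- Fixing the largest element `y` leaves a shorter chain below `y`. Splitting `β` into positive and
negative parts keeps both sides of the equation terms with natural coefficients. -/
theorem mem_chainPoints_cons {D : Set ℕ} {α p q : ℕ} {β : ℤ} {βs : List ℤ} {M : Option ℕ}
    {z : ℕ} : z ∈ chainPoints D α p q (β :: βs) M ↔ ∃ y ∈ D, (∀ b ∈ M, y < b) ∧
      z ∈ chainPoints D α (p + β.toNat * y) (q + (-β).toNat * y) βs (some y) := by
  have hβ : β = (β.toNat : ℤ) - (-β).toNat := by omega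
  constructor
  · rintro ⟨_, ⟨y, hy, hM, v, hv, rfl⟩, h⟩
    refine ⟨y, hy, hM, v, hv, ?_⟩
    rw [hβ] at h
    push_cast
    linarith
  · rintro ⟨y, hy, hM, v, hv, h⟩
    refine ⟨_, ⟨y, hy, hM, v, hv, rfl⟩, ?_⟩
    push_cast at h
    rw [hβ]
    linarith

end ChainSums

/-! ### Definability of the product over one chain. -/

section ProductsOverChains

variable {A : Type*} {lam : A} {𝓜 : Set FinMonoid} {G : FinMonoid}

theorem Definable.subst_zero (hG : G ∈ 𝓜) (hK : 0 < G.K) {n : ℕ}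
    {P : (ℕ → A) → (Fin (n + 1) → ℕ) → Prop} (hP : Definable lam 𝓜 P) {α : ℕ}
    (hα : 0 < α) (p q : Term n) :
    Definable lam 𝓜 fun w u => ∃ z, α * z + q.eval u = p.eval u ∧
      P w (Fin.cons z u : Fin (n + 1) → ℕ) := by
  refine (hP.subst hG hK hα (Fin.cons p fun i => .smul α (.var i) : Fin (n + 1) → Term n)
    (Fin.cons q fun _ => .const 0 : Fin (n + 1) → Term n)).congr' fun w u => ?_
  constructor
  · rintro ⟨z, hz, h⟩
    exact ⟨_, Fin.cases (by simpa using hz) fun i => by simp, h⟩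
  · rintro ⟨v, hv, h⟩
    refine ⟨v 0, by simpa using hv 0, ?_⟩
    rwa [show (Fin.cons (v 0) u : Fin (n + 1) → ℕ) = v from
      funext (Fin.cases rfl fun i => ?_)]
    simpa [hα.ne', eq_comm] using hv i.succ

open Classical in
/-- The ordered product of a definable function over the points of a chain is definable. -/
theorem DefinableFun.limProd_chainPoints (hG : G ∈ 𝓜) (hK : 0 < G.K)
    (hunit : ∀ g : G.carrier, IsUnit g) {α : ℕ} (hα : 0 < α) {βs : List ℤ} (hβs : 0 ∉ βs) {n : ℕ}
    {g : (ℕ → A) → (Fin (n + 1) → ℕ) → G.carrier} (hg : DefinableFun lam 𝓜 g) (p q : Term n)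
    (M : Option (Term n)) :
    DefinableFun lam 𝓜 fun w (u : Fin n → ℕ) => limProd fun z =>
      if z ∈ chainPoints (nnp lam w) α (p.eval u) (q.eval u) βs (M.map fun σ => σ.eval u)
      then g w (Fin.cons z u : Fin (n + 1) → ℕ) else 1 := by
  let : Group G.carrier := groupOfIsUnit hunit
  have := G.finite_carrier
  induction βs generalizing n with
  | nil =>
    intro a
    refine (((hg a).subst_zero hG hK hα p q).or (((definable_const True).subst_zero hG hK hα
      p q).not.and (definable_const (a = 1)))).congr' fun w u => ?_
    have hmem : ∀ z, z ∈ chainPoints (nnp lam w) α (p.eval u) (q.eval u) []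
        (M.map fun σ => σ.eval u) ↔ α * z + q.eval u = p.eval u := by
      intro z
      simp only [chainPoints, chainSums, Set.mem_ofPred_eq, Set.mem_singleton_iff,
        exists_eq_left, add_zero]
      exact_mod_cast Iff.rfl
    simp only [hmem]
    by_cases h : ∃ z, α * z + q.eval u = p.eval u
    · obtain ⟨z, hz⟩ := h
      have hz' : ∀ z', α * z' + q.eval u = p.eval u ↔ z' = z := fun z' => by
        rw [← hz]
        simp [hα.ne']
      rw [limProd_eq_of_forall_ne z fun i hi => if_neg (by rwa [hz'])]
      simp [hz']
    · rw [limProd_eq_one fun i => if_neg fun hi => h ⟨i, hi⟩]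
      simp only [not_exists] at h
      simp [h, eq_comm]
  | cons β βs ih =>
    simp only [List.mem_cons, not_or] at hβs
    -- The largest chain element `y` becomes a new parameter, placed after `z`, which `g` ignores.
    have hg' : DefinableFun lam 𝓜 fun w (v : Fin (n + 2) → ℕ) =>
        g w (Fin.cons (v 0) fun i => v i.succ.succ : Fin (n + 1) → ℕ) := fun a =>
      ((hg a).comp_term hG hK (Fin.cons (.var 0) fun i => .var i.succ.succ :
        Fin (n + 1) → Term (n + 2))).congr' fun w v => by
          refine iff_of_eq (congrArg (fun x => g w x = a) (funext (Fin.cases ?_ fun i => ?_))) <;>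
          simp
    have hin := ih hβs.2 hg' (.add p.shift (.smul β.toNat (.var 0)))
      (.add q.shift (.smul (-β).toNat (.var 0))) (some (.var 0))
    have hM : Definable lam 𝓜 fun _ (v : Fin (n + 1) → ℕ) =>
        ∀ b ∈ M.map fun σ => σ.eval (Fin.tail v), v 0 < b := by
      cases M with
      | none => exact (definable_const True).congr' fun w v => by simp
      | some σ =>
        refine (definable_lt (.var 0) σ.shift).congr' fun w v => ?_
        have := Term.eval_shift_cons σ (v 0) (Fin.tail v)
        rw [Fin.cons_self_tail] at this
        simp [this]
    have hE := DefinableFun.ite hM hin (definableFun_const 1)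
    obtain ⟨B, hBdef⟩ : ∃ B : (ℕ → A) → (Fin n → ℕ) → ℕ → Set ℕ, ∀ w u y, B w u y = {z |
          (∀ b ∈ M.map fun σ => σ.eval u, y < b) ∧ z ∈ chainPoints (nnp lam w) α
            (p.eval u + β.toNat * y) (q.eval u + (-β).toNat * y) βs (some y)} := ⟨_, fun _ _ _ => rfl⟩
    have hB : ∀ w (u : Fin n → ℕ) z, z ∈ chainPoints (nnp lam w) α (p.eval u) (q.eval u)
        (β :: βs) (M.map fun σ => σ.eval u) ↔ ∃ y ∈ nnp lam w, z ∈ B w u y :=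
      fun w u z => by simpa only [hBdef, Set.mem_ofPred_eq] using mem_chainPoints_cons
    have hfin : ∀ w, (nnp lam w).Finite → ∀ (u : Fin n → ℕ), ∀ y ∈ nnp lam w, (B w u y).Finite :=
      fun w hw u y _ => by
        rw [hBdef]
        exact (finite_chainPoints hw hα _ _ _ _).subset fun z hz => hz.2
    have hval : ∀ w (u : Fin n → ℕ) y, limProd (fun z => if z ∈ B w u y then
            g w (Fin.cons z u : Fin (n + 1) → ℕ) else 1) =
          (fun w (v : Fin (n + 1) → ℕ) => if ∀ b ∈ M.map fun σ => σ.eval (Fin.tail v), v 0 < b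
            then limProd fun z =>
            if z ∈ chainPoints (nnp lam w) α ((Term.add p.shift (.smul β.toNat (.var 0))).eval v)
              ((Term.add q.shift (.smul (-β).toNat (.var 0))).eval v) βs
              ((some (Term.var 0)).map fun σ => σ.eval v) then
              g w (Fin.cons ((Fin.cons z v : Fin (n + 2) → ℕ) 0) fun i =>
                (Fin.cons z v : Fin (n + 2) → ℕ) i.succ.succ : Fin (n + 1) → ℕ) else 1
            else 1) w (Fin.cons y u : Fin (n + 1) → ℕ) := by
      intro w u y
      rw [hBdef]
      by_cases hy : ∀ b ∈ M.map fun σ => σ.eval u, y < b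
      · simp only [Set.mem_ofPred_eq, eq_true hy, true_and, if_true, Fin.tail_cons, Fin.cons_zero]
        simp
      · simp only [Set.mem_ofPred_eq, hy, false_and, if_false, Fin.tail_cons, Fin.cons_zero]
        exact limProd_eq_one fun _ => rfl
    -- The bound on `r` from which the blocks of distinct `y` are ordered.
    set R := (2 * (βs.map abs).sum + 2).toNat with hR
    have hr : ∀ r : ℕ, R ≤ r → 2 * (βs.map abs).sum + 1 < r := fun r hr => by omega
    have hαz : ∀ {z z' : ℕ}, (α * z : ℤ) < α * z' → z < z' := fun {z z'} h => by
      exact_mod_cast lt_of_mul_lt_mul_left h (by positivity)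
    have hββ : β = (β.toNat : ℤ) - (-β).toNat := by omega
    -- The sign of the leading coefficient decides whether the blocks descend or ascend with `y`.
    rcases lt_or_gt_of_ne (Ne.symm hβs.1) with hβ | hβ
    · refine ((hE.comp fun a => a⁻¹).limProd_nnp hG |>.comp fun a => a⁻¹).congr R
        fun w hw u => ?_
      simp only [hB]
      refine (limProd_biUnion_of_gt _ hw.1 (hfin w hw.1 u) ?_).trans ?_
      · obtain ⟨-, r, hRr, hD⟩ := hw
        rintro y hy y' hy' hyy' z hzB z' hzB'
        rw [hBdef] at hzB hzB'
        obtain ⟨-, v, hv, hz⟩ := hzB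
        obtain ⟨-, v', hv', hz'⟩ := hzB'
        have := chainSums_gt hβ (hr r hRr) hD hy hy' hyy' hv hv'
        rw [hββ] at this
        push_cast at hz hz'
        exact hαz (by linarith)
      · simp only [hval]
        congr!
    · refine (hE.limProd_nnp hG).congr R fun w hw u => ?_
      simp only [hB]
      refine (limProd_biUnion _ hw.1 (hfin w hw.1 u) ?_).trans ?_
      · obtain ⟨-, r, hRr, hD⟩ := hw
        rintro y hy y' hy' hyy' z hzB z' hzB'
        rw [hBdef] at hzB hzB'
        obtain ⟨-, v, hv, hz⟩ := hzB
        obtain ⟨-, v', hv', hz'⟩ := hzB'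
        have := chainSums_lt hβ (hr r hRr) hD hy hy' hyy' hv hv'
        rw [hββ] at this
        push_cast at hz hz'
        exact hαz (by linarith)
      · simp only [hval]
        congr!

end ProductsOverChains

/-! ### Products over unions of interleaving chains. -/

section ProductsOverChainUnions

theorem limProd_mul_eq_conj {H : Type*} [Group H] {b c : ℕ → H}
    (hb : ∀ᶠ i in Filter.atTop, b i = 1) (hc : ∀ᶠ i in Filter.atTop, c i = 1) :
    limProd (fun z => b z * c z) =
      limProd (fun z => rangeProd c z * b z * (rangeProd c z)⁻¹) * limProd c := by
  obtain ⟨n, hn⟩ := Filter.eventually_atTop.1 (hb.and hc)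
  rw [limProd_eq_rangeProd (n := n) fun i hi => by simp [hn i hi],
    limProd_eq_rangeProd (n := n) fun i hi => by simp [hn i hi],
    limProd_eq_rangeProd (n := n) fun i hi => (hn i hi).2, rangeProd_mul_eq_conj]

theorem Term.eval_shift {n : ℕ} (σ : Term n) (v : Fin (n + 1) → ℕ) :
    σ.shift.eval v = σ.eval (Fin.tail v) := by
  rw [← Term.eval_shift_cons σ (v 0), Fin.cons_self_tail]

/-- The data of a set of points `z` with `den z = p - q + ∑ coeffs_i y_i` for some
`y_1 > y_2 > ⋯`. -/
structure Chain (n : ℕ) where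
  den : ℕ
  p : Term n
  q : Term n
  coeffs : List ℤ
  den_pos : 0 < den
  zero_notMem : 0 ∉ coeffs

namespace Chain

/-- The points of a chain over the set `D`. -/
def points {n : ℕ} (τ : Chain n) (D : Set ℕ) (u : Fin n → ℕ) : Set ℕ :=
  chainPoints D τ.den (τ.p.eval u) (τ.q.eval u) τ.coeffs none

theorem finite_points {n : ℕ} (τ : Chain n) {D : Set ℕ} (hD : D.Finite) (u : Fin n → ℕ) :
    (τ.points D u).Finite :=
  finite_chainPoints hD τ.den_pos _ _ _ _

/-- Shift all variables by one. -/
def shift {n : ℕ} (τ : Chain n) : Chain (n + 1) :=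
  ⟨τ.den, τ.p.shift, τ.q.shift, τ.coeffs, τ.den_pos, τ.zero_notMem⟩

@[simp] theorem points_shift {n : ℕ} (τ : Chain n) (D : Set ℕ) (v : Fin (n + 1) → ℕ) :
    τ.shift.points D v = τ.points D (Fin.tail v) := by
  simp [points, shift, Term.eval_shift]

end Chain

variable {A : Type*} {lam : A} {𝓜 : Set FinMonoid} {G : FinMonoid}

theorem DefinableFun.comp_term {H : Type*} (hG : G ∈ 𝓜) (hK : 0 < G.K) {n m : ℕ}
    {E : (ℕ → A) → (Fin n → ℕ) → H} (hE : DefinableFun lam 𝓜 E) (p : Fin n → Term m) :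
    DefinableFun lam 𝓜 fun w u => E w fun i => (p i).eval u :=
  fun g => (hE g).comp_term hG hK p

-- Membership is read off a product over the chain: put `a ≠ 1` at the point `v 0` and `1`
-- elsewhere, and test whether the product is `a`.
open Classical in
theorem Chain.definable_mem (hG : G ∈ 𝓜) (hK : 0 < G.K) (hunit : ∀ g : G.carrier, IsUnit g)
    {n : ℕ} (τ : Chain n) :
    Definable lam 𝓜 fun w (v : Fin (n + 1) → ℕ) => v 0 ∈ τ.points (nnp lam w) (Fin.tail v) := by
  obtain ⟨a, ha⟩ : ∃ a : G.carrier, a ≠ 1 := ⟨_, (G.enum ⟨0, hK⟩).2⟩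
  have h1 : DefinableFun lam 𝓜 fun (_ : ℕ → A) (v : Fin (n + 2) → ℕ) =>
      if v 0 = v 1 then a else 1 :=
    (DefinableFun.ite (definable_eq (.var 0) (.var 1)) (definableFun_const a)
      (definableFun_const 1)).congr 0 fun _ _ _ => by congr
  refine (DefinableFun.limProd_chainPoints hG hK hunit τ.den_pos τ.zero_notMem h1 τ.p.shift
    τ.q.shift none a).congr' fun w v => ?_
  simp only [Term.eval_shift, Fin.cons_zero, Fin.cons_one, Option.map_none]
  rw [limProd_eq_of_forall_ne (v 0) fun i hi => by simp [hi]]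
  simp only [Chain.points]
  split_ifs with h <;> simp [h, ha.symm]

open Classical in
/-- The ordered product of a definable function over the points of finitely many chains is
definable. -/
theorem DefinableFun.limProd_chains (hG : G ∈ 𝓜) (hK : 0 < G.K)
    (hunit : ∀ g : G.carrier, IsUnit g) {n : ℕ} (L : List (Chain n))
    {g : (ℕ → A) → (Fin (n + 1) → ℕ) → G.carrier} (hg : DefinableFun lam 𝓜 g) :
    DefinableFun lam 𝓜 fun w (u : Fin n → ℕ) => limProd fun z =>
      if ∃ τ ∈ L, z ∈ τ.points (nnp lam w) u
      then g w (Fin.cons z u : Fin (n + 1) → ℕ) else 1 := by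
  let : Group G.carrier := groupOfIsUnit hunit
  have := G.finite_carrier
  -- The number of variables must vary in the induction, because the conjugating prefix products
  -- depend on an additional parameter.
  have key : ∀ k (n : ℕ) (L : List (Chain n)), L.length = k →
      ∀ g : (ℕ → A) → (Fin (n + 1) → ℕ) → G.carrier, DefinableFun lam 𝓜 g →
      DefinableFun lam 𝓜 fun w (u : Fin n → ℕ) => limProd fun z =>
        if ∃ τ ∈ L, z ∈ τ.points (nnp lam w) u
        then g w (Fin.cons z u : Fin (n + 1) → ℕ) else 1 := by
    intro k
    induction k with
    | zero =>
      intro n L hL g hg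
      obtain rfl := List.length_eq_zero_iff.1 hL
      refine (definableFun_const 1).congr 0 fun w _ v => ?_
      exact limProd_eq_one fun i => by simp
    | succ k ih =>
      intro n L hL g hg
      obtain ⟨τ, L, rfl⟩ := List.exists_cons_of_length_eq_add_one hL
      have hL : L.length = k := by simpa using hL
      have hmem := τ.definable_mem (lam := lam) hG hK hunit
      -- the factors at points of the other chains only
      have hc := DefinableFun.ite hmem.not hg (definableFun_const 1)
      have hClim := ih n L hL _ hc
      -- The prefix product of `c` up to `s`: the product over the other chains, restricted to `z <
      -- s`, with `s` as the new parameter.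
      have hC := ih (n + 1) (L.map Chain.shift) (by simpa using hL) _
        (DefinableFun.ite (definable_lt (.var 0) (.var 1)) (hc.comp_term hG hK
          (Fin.cons (.var 0) fun i => .var i.succ.succ : Fin (n + 1) → Term (n + 2)))
          (definableFun_const 1))
      have hb := DefinableFun.limProd_chainPoints hG hK hunit τ.den_pos τ.zero_notMem
        (hC.comp₂ hg fun a b => a * b * a⁻¹) τ.p τ.q none
      refine (hb.comp₂ hClim fun a b => a * b).congr 0 fun w hw u => ?_
      set b : ℕ → G.carrier := fun z => if z ∈ τ.points (nnp lam w) u then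
        g w (Fin.cons z u : Fin (n + 1) → ℕ) else 1 with hbdef
      set c : ℕ → G.carrier := fun z => if ∃ τ ∈ L, z ∈ τ.points (nnp lam w) u then
        (if z ∉ τ.points (nnp lam w) u then g w (Fin.cons z u : Fin (n + 1) → ℕ) else 1)
        else 1 with hcdef
      have hb1 : ∀ᶠ i in Filter.atTop, b i = 1 :=
        eventually_eq_one_of_finite (τ.finite_points hw.1 u) fun i hi => if_neg hi
      have hc1 : ∀ᶠ i in Filter.atTop, c i = 1 := by
        refine eventually_eq_one_of_finite (S := ⋃ τ ∈ {τ | τ ∈ L}, τ.points (nnp lam w) u)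
          (L.finite_toSet.biUnion fun τ _ => τ.finite_points hw.1 u) fun i hi => if_neg ?_
        simpa using hi
      have hbc : ∀ z, (if ∃ τ' ∈ τ :: L, z ∈ τ'.points (nnp lam w) u
          then g w (Fin.cons z u : Fin (n + 1) → ℕ) else 1) = b z * c z := by
        intro z
        by_cases h1 : z ∈ τ.points (nnp lam w) u
        · simp [hbdef, hcdef, h1]
        · simp [hbdef, hcdef, h1]
      have hrange : ∀ s, rangeProd c s = limProd fun z => if ∃ τ ∈ L.map Chain.shift,
          z ∈ τ.points (nnp lam w) (Fin.cons s u : Fin (n + 1) → ℕ) then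
          (if z < s then (if z ∉ τ.points (nnp lam w) u then
            g w (Fin.cons z u : Fin (n + 1) → ℕ) else 1) else 1) else 1 := by
        intro s
        rw [limProd_eq_rangeProd (n := s)]
        · refine rangeProd_congr fun i hi => ?_
          simp [hcdef, hi]
        · intro i hi
          simp [not_lt.2 hi]
      have hcons : ∀ s z, (fun i => ((Fin.cons (.var 0) fun i => .var i.succ.succ :
          Fin (n + 1) → Term (n + 2)) i).eval (Fin.cons z (Fin.cons s u : Fin (n + 1) → ℕ) :
            Fin (n + 2) → ℕ)) = (Fin.cons z u : Fin (n + 1) → ℕ) := by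
        intro s z
        refine funext (Fin.cases ?_ fun i => ?_) <;> simp
      rw [limProd_congr hbc, limProd_mul_eq_conj hb1 hc1]
      simp only [hrange, hcons, Fin.cons_zero, Fin.tail_cons, Term.eval_var, Fin.cons_one]
      refine congrArg₂ _ (limProd_congr fun z => ?_) ?_
      · by_cases hz : z ∈ τ.points (nnp lam w) u
        · rw [hbdef]
          have hz' : z ∈ chainPoints (nnp lam w) τ.den (τ.p.eval u) (τ.q.eval u) τ.coeffs
            (none.map fun σ : Term n => σ.eval u) := hz
          simp only [if_pos hz, if_pos hz']
        · have hz' : z ∉ chainPoints (nnp lam w) τ.den (τ.p.eval u) (τ.q.eval u) τ.coeffs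
            (none.map fun σ : Term n => σ.eval u) := hz
          simp only [hbdef, if_neg hz, if_neg hz', mul_one, mul_inv_cancel]
      · rfl
  exact key L.length n L rfl g hg

end ProductsOverChainUnions

/-! ### Periodicity of active domain formulas away from zeros of linear forms. -/

section LocalPeriodicity

/-- `v` is a zero of a linear form with bounded coefficients that depends on the variable `i` and
involves additional values from `D`. -/
def NearZero (D : Set ℕ) {n : ℕ} (i : Fin n) (C : ℕ) (v : Fin n → ℕ) : Prop :=
  ∃ (a : Fin n → ℤ) (c : ℤ) (e : ℕ →₀ ℤ), a i ≠ 0 ∧ (∀ j, |a j| ≤ C) ∧ |c| ≤ C ∧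
    ↑e.support ⊆ D ∧ (e.sum fun _ x => |x|) ≤ C ∧ ∑ j, a j * (v j : ℤ) + c +
      (e.sum fun d x => x * (d : ℤ)) = 0

theorem NearZero.mono {D : Set ℕ} {n : ℕ} {i : Fin n} {C C' : ℕ} (hC : C ≤ C') {v : Fin n → ℕ}
    (h : NearZero D i C v) : NearZero D i C' v := by
  obtain ⟨a, c, e, h1, h2, h3, h4, h5, h6⟩ := h
  have : (C : ℤ) ≤ C' := by exact_mod_cast hC
  exact ⟨a, c, e, h1, fun j => (h2 j).trans this, h3.trans this, h4, h5.trans this, h6⟩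

/-- A bound variable with value `y ∈ D` is absorbed into the part of the form supported on `D`. Its
coefficient adds at most `C` to the total weight, hence the factor `2`. -/
theorem NearZero.of_cons {D : Set ℕ} {n : ℕ} {i : Fin n} {C : ℕ} {v : Fin n → ℕ} {y : ℕ}
    (hy : y ∈ D) (h : NearZero D i.succ C (Fin.cons y v : Fin (n + 1) → ℕ)) :
    NearZero D i (2 * C) v := by
  classical
  obtain ⟨a, c, e, h1, h2, h3, h4, h5, h6⟩ := h
  have hC : (C : ℤ) ≤ (2 * C : ℕ) := by push_cast; omega
  refine ⟨fun j => a j.succ, c, e + Finsupp.single y (a 0), h1, fun j => (h2 _).trans hC,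
    h3.trans hC, ?_, ?_, ?_⟩
  · intro d hd
    rcases Finset.mem_union.1 (Finsupp.support_add hd) with h | h
    · exact h4 h
    · rw [Finset.mem_singleton.1 (Finsupp.support_single_subset h)]
      exact hy
  · have hs : (e + Finsupp.single y (a 0)).support ⊆ e.support ∪ {y} :=
      Finsupp.support_add.trans (Finset.union_subset_union_right Finsupp.support_single_subset)
    rw [Finsupp.sum_of_support_subset _ hs _ (by simp)]
    rw [Finsupp.sum_of_support_subset e (s := e.support ∪ {y}) (by simp) _ (by simp)] at h5
    calc ∑ d ∈ e.support ∪ {y}, |(e + Finsupp.single y (a 0)) d|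
        ≤ ∑ d ∈ e.support ∪ {y}, (|e d| + if d = y then |a 0| else 0) := by
          refine Finset.sum_le_sum fun d _ => ?_
          rw [Finsupp.add_apply, Finsupp.single_apply]
          refine (abs_add_le _ _).trans ?_
          split_ifs with h1 h2 h2
          · rfl
          · exact absurd h1.symm h2
          · exact absurd h2.symm h1
          · simp
      _ = ∑ d ∈ e.support ∪ {y}, |e d| + |a 0| := by
          rw [Finset.sum_add_distrib, Finset.sum_ite_eq' _ y, if_pos (by simp)]
      _ ≤ (2 * C : ℕ) := by
          have := h2 0
          push_cast
          linarith
  · rw [Finsupp.sum_add_index' (by simp) (by intros; ring), Finsupp.sum_single_index (by simp)]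
    rw [Fin.sum_univ_succ] at h6
    simp only [Fin.cons_zero, Fin.cons_succ] at h6
    linarith

theorem NearZero.of_form {D : Set ℕ} {n : ℕ} {i : Fin n} {C : ℕ} {v : Fin n → ℕ}
    {a : Fin n → ℤ} {c : ℤ} (h1 : a i ≠ 0) (h2 : ∀ j, |a j| ≤ C) (h3 : |c| ≤ C)
    (h : ∑ j, a j * (v j : ℤ) + c = 0) : NearZero D i C v :=
  ⟨a, c, 0, h1, h2, h3, by simp, by simp, by simpa using h⟩

theorem NearZero.of_form_eq_mem {D : Set ℕ} {n : ℕ} {i : Fin n} {C : ℕ} {v : Fin n → ℕ}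
    {a : Fin n → ℤ} {c : ℤ} {y : ℕ} (h1 : a i ≠ 0) (h2 : ∀ j, |a j| ≤ C) (h3 : |c| ≤ C)
    (hC : 1 ≤ C) (hy : y ∈ D) (h : ∑ j, a j * (v j : ℤ) + c = y) : NearZero D i C v := by
  refine ⟨a, c, Finsupp.single y (-1), h1, h2, h3, ?_, ?_, ?_⟩
  · intro d hd
    rw [Finset.mem_singleton.1 (Finsupp.support_single_subset hd)]
    exact hy
  · rw [Finsupp.sum_single_index (by simp)]
    simpa using hC
  · rw [Finsupp.sum_single_index (by simp)]
    linarith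

/-- The values of a term are given by a linear form. -/
theorem Term.exists_form {n : ℕ} (σ : Term n) :
    ∃ (a : Fin n → ℤ) (c : ℤ), ∀ v, (σ.eval v : ℤ) = ∑ j, a j * (v j : ℤ) + c := by
  classical
  induction σ with
  | var i => exact ⟨Pi.single i 1, 0, fun v => by simp [Pi.single_apply]⟩
  | const c => exact ⟨0, c, fun v => by simp⟩
  | add σ τ h1 h2 =>
    obtain ⟨a, c, h⟩ := h1
    obtain ⟨a', c', h'⟩ := h2
    refine ⟨a + a', c + c', fun v => ?_⟩
    simp only [eval_add, Nat.cast_add, h, h', Pi.add_apply, add_mul, Finset.sum_add_distrib]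
    ring

theorem sum_update_add {n : ℕ} (a : Fin n → ℤ) (i : Fin n) (v : Fin n → ℕ) (N : ℕ) :
    ∑ j, a j * ((Function.update v i (v i + N) j : ℕ) : ℤ) =
      ∑ j, a j * (v j : ℤ) + a i * N := by
  classical
  rw [← Finset.add_sum_erase _ _ (Finset.mem_univ i),
    ← Finset.add_sum_erase (a := i) (f := fun j => a j * (v j : ℤ)) _ (Finset.mem_univ i)]
  rw [Function.update_self, Finset.sum_congr rfl fun j hj => by
    rw [Function.update_of_ne (Finset.ne_of_mem_erase hj)]]
  push_cast
  ring

/-- The sign of a linear form changes under a shift of the variable `i` only near its zeros. -/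
theorem exists_sign_shift {n : ℕ} (i : Fin n) (a : Fin n → ℤ) (c : ℤ) (N : ℕ) :
    ∃ C : ℕ, ∀ (D : Set ℕ) (v : Fin n → ℕ), ¬ NearZero D i C v →
      ((0 < ∑ j, a j * (v j : ℤ) + c ↔
        0 < ∑ j, a j * ((Function.update v i (v i + N) j : ℕ) : ℤ) + c) ∧
      (0 = ∑ j, a j * (v j : ℤ) + c ↔
        0 = ∑ j, a j * ((Function.update v i (v i + N) j : ℕ) : ℤ) + c)) := by
  by_cases hi : a i = 0
  · exact ⟨0, fun D v _ => by simp [sum_update_add, hi]⟩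
  have hC : ∃ C : ℕ, (∀ j, |a j| ≤ C) ∧ |c| + |a i * N| ≤ C := by
    refine ⟨(∑ j, |a j| + (|c| + |a i * N|)).toNat, ?_⟩
    have h1 : ∀ j, |a j| ≤ ∑ j, |a j| := fun j =>
      Finset.single_le_sum (fun j _ => abs_nonneg (a j)) (Finset.mem_univ j)
    have h0 : 0 ≤ ∑ j, |a j| := Finset.sum_nonneg fun j _ => abs_nonneg (a j)
    have h2 := abs_nonneg c
    have h3 := abs_nonneg (a i * N)
    rw [Int.toNat_of_nonneg (by linarith)]
    exact ⟨fun j => by linarith [h1 j], by linarith⟩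
  obtain ⟨C, h1, h2⟩ := hC
  refine ⟨C, fun D v hv => ?_⟩
  rw [sum_update_add]
  set s := ∑ j, a j * (v j : ℤ) with hs
  -- The form stays farther from zero than the shift moves it, so its sign cannot change.
  have key : ∀ x : ℤ, |x| ≤ |a i * N| → s + c + x ≠ 0 := by
    intro x hx h
    refine hv (NearZero.of_form hi h1 (c := c + x) ?_ (by rw [← hs]; linarith))
    exact (abs_add_le _ _).trans (by linarith)
  have k0 := key 0 (by rw [abs_zero]; exact abs_nonneg _)
  have k1 := key _ le_rfl
  have k2 := key (-(s + c))
  rw [abs_neg] at k2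
  have k3 : |a i * N| < |s + c| := by
    by_contra hcon
    exact k2 (not_lt.1 hcon) (by ring)
  generalize a i * (N : ℤ) = t at *
  rcases abs_cases t with ⟨h, _⟩ | ⟨h, _⟩ <;> rcases abs_cases (s + c) with ⟨h', _⟩ | ⟨h', _⟩ <;>
    constructor <;> constructor <;> intro _ <;> omega

/-- Active domain formulas are periodic in each variable, except near the zeros of finitely many
linear forms. -/
theorem Formula.IsActiveDomain.locally_periodic {A : Type*} {lam : A} {n : ℕ} {θ : Formula A n}
    (hθ : θ.IsActiveDomain lam) (i : Fin n) :
    ∃ q : ℕ, 0 < q ∧ ∀ N, q ∣ N → ∃ C, ∀ w v, ¬ NearZero (nnp lam w) i C v →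
      (θ.Sat w v ↔ θ.Sat w (Function.update v i (v i + N))) := by
  induction hθ with
  | letter c σ =>
    refine ⟨1, one_pos, fun N _ => ?_⟩
    obtain ⟨a, b, hab⟩ := σ.exists_form
    by_cases hi : a i = 0
    · refine ⟨0, fun w v _ => ?_⟩
      have : σ.eval (Function.update v i (v i + N)) = σ.eval v := by
        have := hab (Function.update v i (v i + N))
        rw [sum_update_add, hi, zero_mul, add_zero, ← hab] at this
        exact_mod_cast this
      simp only [Sat, this]
    · have h0 : 0 ≤ ∑ j, |a j| := Finset.sum_nonneg fun j _ => abs_nonneg (a j)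
      have h1 : ∀ j, |a j| ≤ ∑ j, |a j| := fun j =>
        Finset.single_le_sum (fun j _ => abs_nonneg (a j)) (Finset.mem_univ j)
      -- The final `+ 1` makes room for the coefficient `-1` of the active position that `σ` would
      -- hit.
      refine ⟨(∑ j, |a j| + |b| + |a i * N| + 1).toNat, fun w v hv => ?_⟩
      have hC : ((∑ j, |a j| + |b| + |a i * N| + 1).toNat : ℤ) =
          ∑ j, |a j| + |b| + |a i * N| + 1 := Int.toNat_of_nonneg (by positivity)
      have hb := abs_nonneg b
      have hN := abs_nonneg (a i * N)
      -- Neither the old nor the new position is active, so both carry `lam`.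
      have key : ∀ x : ℤ, |x| ≤ |a i * N| → ∀ y : ℕ, (y : ℤ) = ∑ j, a j * (v j : ℤ) + b + x →
          w y = lam := by
        intro x hx y hy
        by_contra hcon
        refine hv (NearZero.of_form_eq_mem (c := b + x) hi (fun j => ?_) ?_ (by omega) hcon
          (by rw [hy]; ring))
        · rw [hC]
          linarith [h1 j]
        · rw [hC]
          exact (abs_add_le _ _).trans (by linarith)
      have e1 := key 0 (by rw [abs_zero]; exact hN) (σ.eval v) (by rw [hab]; ring)
      have e2 := key (a i * N) le_rfl (σ.eval (Function.update v i (v i + N)))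
        (by rw [hab, sum_update_add]; ring)
      simp only [Sat, e1, e2]
  | eq σ τ =>
    refine ⟨1, one_pos, fun N _ => ?_⟩
    obtain ⟨a, b, hab⟩ := σ.exists_form
    obtain ⟨a', b', hab'⟩ := τ.exists_form
    obtain ⟨C, hC⟩ := exists_sign_shift i (a - a') (b - b') N
    refine ⟨C, fun w v hv => ?_⟩
    have := (hC _ v hv).2
    simp only [Pi.sub_apply, sub_mul, Finset.sum_sub_distrib] at this
    have e1 := hab v
    have e2 := hab' v
    have e3 := hab (Function.update v i (v i + N))
    have e4 := hab' (Function.update v i (v i + N))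
    simp only [Sat]
    omega
  | lt σ τ =>
    refine ⟨1, one_pos, fun N _ => ?_⟩
    obtain ⟨a, b, hab⟩ := σ.exists_form
    obtain ⟨a', b', hab'⟩ := τ.exists_form
    obtain ⟨C, hC⟩ := exists_sign_shift i (a' - a) (b' - b) N
    refine ⟨C, fun w v hv => ?_⟩
    have := (hC _ v hv).1
    simp only [Pi.sub_apply, sub_mul, Finset.sum_sub_distrib] at this
    have e1 := hab v
    have e2 := hab' v
    have e3 := hab (Function.update v i (v i + N))
    have e4 := hab' (Function.update v i (v i + N))
    simp only [Sat]
    omega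
  | modEq k hk σ τ =>
    refine ⟨k, by omega, fun N hN => ⟨0, fun w v _ => ?_⟩⟩
    have key : ∀ σ : Term _, σ.eval (Function.update v i (v i + N)) ≡ σ.eval v [MOD k] := by
      intro σ
      induction σ with
      | var j =>
        rcases eq_or_ne j i with rfl | hj
        · obtain ⟨l, rfl⟩ := hN
          simp [Nat.ModEq]
        · simp [hj, Nat.ModEq]
      | const c => rfl
      | add σ τ h1 h2 => exact h1.add h2
    exact ⟨fun h => ((key σ).trans h).trans (key τ).symm,
      fun h => ((key σ).symm.trans h).trans (key τ)⟩
  | neg _ ih =>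
    obtain ⟨q, hq, h⟩ := ih i
    exact ⟨q, hq, fun N hN => (h N hN).imp fun C hC w v hv => not_congr (hC w v hv)⟩
  | and _ _ ih ih' =>
    obtain ⟨q, hq, h⟩ := ih i
    obtain ⟨q', hq', h'⟩ := ih' i
    refine ⟨q * q', Nat.mul_pos hq hq', fun N hN => ?_⟩
    obtain ⟨C, hC⟩ := h N ((dvd_mul_right q q').trans hN)
    obtain ⟨C', hC'⟩ := h' N ((dvd_mul_left q' q).trans hN)
    exact ⟨max C C', fun w v hv => and_congr (hC w v fun h => hv (h.mono (le_max_left _ _)))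
      (hC' w v fun h => hv (h.mono (le_max_right _ _)))⟩
  | or _ _ ih ih' =>
    obtain ⟨q, hq, h⟩ := ih i
    obtain ⟨q', hq', h'⟩ := ih' i
    refine ⟨q * q', Nat.mul_pos hq hq', fun N hN => ?_⟩
    obtain ⟨C, hC⟩ := h N ((dvd_mul_right q q').trans hN)
    obtain ⟨C', hC'⟩ := h' N ((dvd_mul_left q' q).trans hN)
    exact ⟨max C C', fun w v hv => or_congr (hC w v fun h => hv (h.mono (le_max_left _ _)))
      (hC' w v fun h => hv (h.mono (le_max_right _ _)))⟩
  | @quant n M m φ _ ih =>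
    choose q hq h using fun j => ih j i.succ
    refine ⟨∏ j, q j, Finset.prod_pos fun j _ => hq j, fun N hN => ?_⟩
    choose C hC using fun j => h j N ((Finset.dvd_prod_of_mem q (Finset.mem_univ j)).trans hN)
    refine ⟨2 * Finset.univ.sup C, fun w v hv => ?_⟩
    simp only [Sat, Term.eval_var, Fin.cons_zero]
    -- The active domain guard is essential: only an active `y` can be absorbed by
    -- `NearZero.of_cons`. The shift thus leaves every factor of the product unchanged.
    have : ∀ y j, (¬ w y = lam ∧ (φ j).Sat w (Fin.cons y v : Fin (n + 1) → ℕ)) ↔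
        (¬ w y = lam ∧ (φ j).Sat w
          (Fin.cons y (Function.update v i (v i + N)) : Fin (n + 1) → ℕ)) := by
      intro y j
      refine and_congr_right fun hy => ?_
      rw [hC j w _ fun hnear => hv ?_, ← Fin.cons_update, Fin.cons_succ]
      exact (NearZero.of_cons hy hnear).mono
        (Nat.mul_le_mul_left _ (Finset.le_sup (Finset.mem_univ j)))
    simp only [this]

end LocalPeriodicity

/-! ### Covering the exceptional points by finitely many chains. -/

section Chains

/-- Adding elements in increasing order puts each new maximum at the head of the chain. -/
theorem exists_mem_chainSums {D : Set ℕ} (e : ℕ → ℤ) (s : Finset ℕ) (hs : ↑s ⊆ D)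
    (M : Option ℕ) (hM : ∀ d ∈ s, ∀ b ∈ M, d < b) :
    ∃ βs : List ℤ, βs.length = s.card ∧ (∀ β ∈ βs, ∃ d ∈ s, β = e d) ∧
      ∑ d ∈ s, e d * (d : ℤ) ∈ chainSums D βs M := by
  induction s using Finset.induction_on_max generalizing M with
  | empty => exact ⟨[], rfl, by simp, rfl⟩
  | insert a s ha ih =>
    obtain ⟨βs, h1, h2, h3⟩ := ih (fun d hd => hs (by simp [Finset.mem_coe.1 hd])) (some a)
      (by simpa using ha)
    have has : a ∉ s := fun h => lt_irrefl _ (ha a h)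
    refine ⟨e a :: βs, by simp [h1, has], ?_, a, hs (by simp), hM a (by simp), _, h3,
      Finset.sum_insert has⟩
    intro β hβ
    rcases List.mem_cons.1 hβ with rfl | hβ
    · exact ⟨a, by simp, rfl⟩
    · obtain ⟨d, hd, h⟩ := h2 β hβ
      exact ⟨d, by simp [hd], h⟩

theorem Term.exists_eval_eq {n : ℕ} (a : Fin n → ℕ) (c : ℕ) :
    ∃ σ : Term n, ∀ v, σ.eval v = ∑ j, a j * v j + c := by
  classical
  have : ∀ s : Finset (Fin n), ∃ σ : Term n, ∀ v, σ.eval v = ∑ j ∈ s, a j * v j + c := by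
    intro s
    induction s using Finset.induction_on with
    | empty => exact ⟨.const c, fun v => by simp⟩
    | insert j s hj ih =>
      obtain ⟨σ, hσ⟩ := ih
      exact ⟨.add (.smul (a j) (.var j)) σ, fun v => by simp [hσ, Finset.sum_insert hj, add_assoc]⟩
  exact this Finset.univ

/-- The zeros of a linear form in its first variable are the points of a chain. -/
theorem Chain.exists_points {n : ℕ} (a : Fin (n + 1) → ℤ) (c : ℤ) (βs : List ℤ)
    (ha : a 0 < 0) (hβs : 0 ∉ βs) :
    ∃ τ : Chain n, ∀ (D : Set ℕ) (z : ℕ) (u : Fin n → ℕ), ∀ x ∈ chainSums D βs none,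
      ∑ j, a j * ((Fin.cons z u : Fin (n + 1) → ℕ) j : ℤ) + c + x = 0 → z ∈ τ.points D u := by
  obtain ⟨p, hp⟩ := Term.exists_eval_eq (fun j : Fin n => (a j.succ).toNat) c.toNat
  obtain ⟨q, hq⟩ := Term.exists_eval_eq (fun j : Fin n => (-a j.succ).toNat) (-c).toNat
  refine ⟨⟨(-a 0).toNat, p, q, βs, by omega, hβs⟩, fun D z u x hx h => ⟨x, hx, ?_⟩⟩
  rw [Fin.sum_univ_succ] at h
  simp only [Fin.cons_zero, Fin.cons_succ] at h
  have h1 : ∑ j : Fin n, a j.succ * (u j : ℤ) =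
      ∑ j : Fin n, ((a j.succ).toNat : ℤ) * u j - ∑ j : Fin n, ((-a j.succ).toNat : ℤ) * u j := by
    rw [← Finset.sum_sub_distrib]
    refine Finset.sum_congr rfl fun j _ => ?_
    rw [← sub_mul]
    congr 1
    omega
  have h2 : c = (c.toNat : ℤ) - (-c).toNat := by omega
  have h3 : a 0 = -((-a 0).toNat : ℤ) := by omega
  rw [h1, h2, h3] at h
  simp only [hp, hq]
  push_cast
  linarith

theorem finite_bounded_forms (n C : ℕ) :
    {x : (Fin n → ℤ) × ℤ × List ℤ | (∀ j, |x.1 j| ≤ C) ∧ |x.2.1| ≤ C ∧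
      x.2.2.length ≤ C ∧ ∀ β ∈ x.2.2, |β| ≤ C}.Finite := by
  have h1 : {a : Fin n → ℤ | ∀ j, |a j| ≤ C}.Finite := by
    refine (Set.Finite.pi' (t := fun _ => Set.Icc (-(C : ℤ)) C)
      fun _ => Set.finite_Icc _ _).subset ?_
    exact fun a ha j => abs_le.1 (ha j)
  have h2 : {c : ℤ | |c| ≤ C}.Finite :=
    (Set.finite_Icc (-(C : ℤ)) C).subset fun c hc => abs_le.1 hc
  have h3 : {l : List ℤ | l.length ≤ C ∧ ∀ β ∈ l, |β| ≤ C}.Finite := by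
    have := h2.to_subtype
    refine ((List.finite_length_le {c : ℤ | |c| ≤ C} C).image (List.map Subtype.val)).subset ?_
    rintro l ⟨hl, hβ⟩
    refine ⟨l.attach.map fun β => ⟨β.1, hβ β.1 β.2⟩, ?_, ?_⟩
    · change (List.map _ _).length ≤ C
      simpa using hl
    simp [List.map_map, Function.comp_def]
  exact (h1.prod (h2.prod h3)).subset fun x hx => ⟨hx.1, hx.2.1, hx.2.2⟩

/-- The points near zeros of bounded linear forms are covered by finitely many chains. -/
theorem exists_chains_of_nearZero (n C : ℕ) :
    ∃ L : List (Chain n), ∀ (D : Set ℕ) (z : ℕ) (u : Fin n → ℕ),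
      NearZero D 0 C (Fin.cons z u : Fin (n + 1) → ℕ) → ∃ τ ∈ L, z ∈ τ.points D u := by
  have hchain : ∀ x : (Fin (n + 1) → ℤ) × ℤ × List ℤ, ∃ τ : Chain n, x.1 0 < 0 → 0 ∉ x.2.2 →
      ∀ (D : Set ℕ) (z : ℕ) (u : Fin n → ℕ), ∀ y ∈ chainSums D x.2.2 none,
      ∑ j, x.1 j * ((Fin.cons z u : Fin (n + 1) → ℕ) j : ℤ) + x.2.1 + y = 0 →
        z ∈ τ.points D u := by
    intro x
    by_cases h : x.1 0 < 0 ∧ 0 ∉ x.2.2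
    · exact (Chain.exists_points x.1 x.2.1 x.2.2 h.1 h.2).imp fun τ hτ _ _ => hτ
    -- An arbitrary chain for the irrelevant forms.
    · exact ⟨⟨1, .const 0, .const 0, [], one_pos, by simp⟩, fun h1 h2 => absurd ⟨h1, h2⟩ h⟩
  choose τ hτ using hchain
  refine ⟨(finite_bounded_forms (n + 1) C).toFinset.toList.map τ, fun D z u h => ?_⟩
  -- Negating the form if necessary makes the coefficient of `z` negative, so that `z` can be
  -- isolated with a positive denominator.
  obtain ⟨a, c, e, h1, h2, h3, h4, h5, h6⟩ : ∃ (a : Fin (n + 1) → ℤ) (c : ℤ) (e : ℕ →₀ ℤ),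
      a 0 < 0 ∧ (∀ j, |a j| ≤ C) ∧ |c| ≤ C ∧ ↑e.support ⊆ D ∧ (e.sum fun _ x => |x|) ≤ C ∧
      ∑ j, a j * ((Fin.cons z u : Fin (n + 1) → ℕ) j : ℤ) + c +
        (e.sum fun d x => x * (d : ℤ)) = 0 := by
    obtain ⟨a, c, e, h1, h2, h3, h4, h5, h6⟩ := h
    rcases lt_or_gt_of_ne h1 with h | h
    · exact ⟨a, c, e, h, h2, h3, h4, h5, h6⟩
    · refine ⟨-a, -c, -e, by simpa using h, by simpa using h2, by simpa using h3, by simpa using h4,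
        ?_, ?_⟩
      · rw [Finsupp.sum_neg_index (by simp)]
        simpa using h5
      · rw [Finsupp.sum_neg_index (by simp)]
        simp only [Pi.neg_apply, neg_mul, Finset.sum_neg_distrib, Finsupp.sum_neg]
        linarith
  obtain ⟨βs, hlen, hmem, hsum⟩ := exists_mem_chainSums (D := D) e e.support h4 none (by simp)
  have hle : ∀ d ∈ e.support, |e d| ≤ C := fun d hd =>
    (Finset.single_le_sum (f := fun d => |e d|) (fun d _ => abs_nonneg _) hd).trans h5
  -- Each coefficient on the support is a nonzero integer, so the weight bound also limits the
  -- length of the chain.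
  have hcard : (e.support.card : ℤ) ≤ C := by
    refine le_trans ?_ h5
    rw [Finsupp.sum, Finset.cast_card]
    exact Finset.sum_le_sum fun d hd => Int.one_le_abs (Finsupp.mem_support_iff.1 hd)
  refine ⟨τ (a, c, βs), List.mem_map_of_mem ?_, hτ (a, c, βs) h1 ?_ D z u _ hsum h6⟩
  · simp only [Finset.mem_toList, Set.Finite.mem_toFinset, Set.mem_ofPred_eq]
    refine ⟨h2, h3, by rw [hlen]; exact_mod_cast hcard, fun β hβ => ?_⟩
    obtain ⟨d, hd, rfl⟩ := hmem β hβ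
    exact hle d hd
  · intro h0
    obtain ⟨d, hd, h⟩ := hmem 0 h0
    exact Finsupp.mem_support_iff.1 hd h.symm

theorem NearZero.of_add {D : Set ℕ} {n : ℕ} {C : ℕ} {z i N : ℕ} {u : Fin n → ℕ} (hi : i ≤ N)
    (h : NearZero D 0 C (Fin.cons (z + i) u : Fin (n + 1) → ℕ)) :
    NearZero D 0 (C + C * N) (Fin.cons z u : Fin (n + 1) → ℕ) := by
  obtain ⟨a, c, e, h1, h2, h3, h4, h5, h6⟩ := h
  have hi' : (i : ℤ) ≤ N := by exact_mod_cast hi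
  have hC : (C : ℤ) ≤ (C + C * N : ℕ) := by push_cast; nlinarith
  refine ⟨a, c + a 0 * i, e, h1, fun j => (h2 j).trans hC, ?_, h4, h5.trans hC, ?_⟩
  · refine (abs_add_le _ _).trans ?_
    rw [abs_mul, Nat.abs_cast]
    push_cast
    have := h2 0
    gcongr
  · rw [Fin.sum_univ_succ] at h6 ⊢
    simp only [Fin.cons_zero, Fin.cons_succ] at h6 ⊢
    push_cast at h6
    linarith

end Chains

/-! ### Reduction of the infinite product to exceptional windows. -/

section Collapse

open Classical in
/-- A product is eventually constant when it is so along each residue class modulo `N`. -/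
theorem eventually_rangeProd_eq_iff {H : Type*} [Monoid H] (f : ℕ → H) {N : ℕ} (hN : 0 < N)
    {B : Set ℕ} (hB : B.Finite) (hf : ∀ z ∉ B, rangeProd (fun i => f (z + i)) N = 1) (m : H) :
    (∀ᶠ k in Filter.atTop, rangeProd f k = m) ↔ ∀ j : Fin N, rangeProd f j *
      limProd (fun z => if z ∈ B then
        (if z % N = j then rangeProd (fun i => f (z + i)) N else 1) else 1) = m := by
  set h : ℕ → ℕ → H := fun j z => if z ∈ B then
        (if z % N = j then rangeProd (fun i => f (z + i)) N else 1) else 1 with hh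
  have hh' : ∀ j z, h j z = if z % N = j then rangeProd (fun i => f (z + i)) N else 1 := by
    intro j z
    by_cases hz : z ∈ B
    · simp [hh, hz]
    · simp [hh, hz, hf z hz]
  -- After the first `j` factors the product splits into windows starting at positions `≡ j` modulo
  -- `N`. In `h j`, the whole product of a window sits at its starting point.
  have hprod : ∀ j < N, ∀ k, rangeProd f (j + N * k) =
      rangeProd f j * rangeProd (h j) (j + N * k) := by
    intro j hj k
    rw [rangeProd_add, rangeProd_add (h j), rangeProd_mul, rangeProd_mul,
      rangeProd_eq_one (g := h j) (n := j) fun i hi => ?_, one_mul]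
    · congr 1
      refine rangeProd_congr fun l _ => ?_
      -- Within a window only the first position is `≡ j`; the other `n` factors of `h j` are `1`.
      obtain ⟨n, rfl⟩ : ∃ n, N = 1 + n := ⟨N - 1, by omega⟩
      rw [rangeProd_add (fun i => h j (j + ((1 + n) * l + i))),
        rangeProd_eq_one (n := n) fun i hi => ?_, rangeProd_succ, rangeProd_zero, one_mul, mul_one,
        hh', if_pos ?_]
      · simp only [add_assoc, add_zero]
      · simp [Nat.add_mul_mod_self_left, Nat.mod_eq_of_lt hj]
      · rw [hh', if_neg]
        rw [show j + ((1 + n) * l + (1 + i)) = (j + (1 + i)) + (1 + n) * l by ring,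
          Nat.add_mul_mod_self_left]
        intro hcon
        rcases lt_or_ge (j + (1 + i)) (1 + n) with hlt | hge
        · rw [Nat.mod_eq_of_lt hlt] at hcon
          omega
        · rw [Nat.mod_eq_sub_mod hge, Nat.mod_eq_of_lt (by omega)] at hcon
          omega
    · rw [hh', if_neg]
      rw [Nat.mod_eq_of_lt (by omega)]
      omega
  have hev : ∀ j, ∃ n₀, ∀ n, n₀ ≤ n → rangeProd (h j) n = limProd (h j) := fun j =>
    Filter.eventually_atTop.1 (eventually_rangeProd_eq_limProd
      (eventually_eq_one_of_finite hB fun i hi => if_neg hi))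
  choose n₀ hn₀ using hev
  constructor
  · rintro hm j
    obtain ⟨k₀, hk₀⟩ := Filter.eventually_atTop.1 hm
    have hle : max k₀ (n₀ j) ≤ j + N * max k₀ (n₀ j) :=
      (Nat.le_mul_of_pos_left _ hN).trans (Nat.le_add_left _ _)
    rw [← hn₀ j _ ((le_max_right _ _).trans hle), ← hprod j j.2]
    exact hk₀ _ ((le_max_left _ _).trans hle)
  · intro hm
    refine Filter.eventually_atTop.2 ⟨N * (Finset.range N).sup n₀, fun k hk => ?_⟩
    have hj := Nat.mod_lt k hN
    have h1 : n₀ (k % N) ≤ k := (Finset.le_sup (Finset.mem_range.2 hj)).trans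
      ((Nat.le_mul_of_pos_left _ hN).trans hk)
    have := hprod (k % N) hj (k / N)
    rw [Nat.mod_add_div, hn₀ _ k h1] at this
    rw [this]
    exact hm ⟨k % N, hj⟩

theorem Formula.sat_quant {A : Type*} {w : ℕ → A} {n : ℕ} {M : FinMonoid} {m : M.carrier}
    {φ : Fin M.K → Formula A (n + 1)} {v : Fin n → ℕ} :
    (Formula.quant M m φ).Sat w v ↔ ∀ᶠ k in Filter.atTop, rangeProd
      (fun i => M.pick fun j => (φ j).Sat w (Fin.cons i v : Fin (n + 1) → ℕ)) k = m :=
  Iff.rfl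

/-- The quantifier of a nontrivial group applied to active domain formulas is definable by an
active domain formula. -/
theorem definable_quant {A : Type*} {lam : A} {𝓜 : Set FinMonoid} {G : FinMonoid} (hG : G ∈ 𝓜)
    (hK : 0 < G.K) (hunit : ∀ g : G.carrier, IsUnit g) (m : G.carrier) {t : ℕ}
    {φ : Fin G.K → Formula A (t + 1)} (hφ : ∀ j, (φ j).IsActiveDomain lam)
    (hmon : ∀ j, (φ j).monoids ⊆ 𝓜) :
    Definable lam 𝓜 fun w a => (Formula.quant G m φ).Sat w a := by
  classical
  let : Group G.carrier := groupOfIsUnit hunit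
  have := G.finite_carrier
  set f : (ℕ → A) → (Fin (t + 1) → ℕ) → G.carrier := fun w v => G.pick fun j => (φ j).Sat w v
    with hfdef
  have hf : DefinableFun lam 𝓜 f := .pick fun j => definable_sat (hφ j) (hmon j)
  choose q hq hper using fun j => (hφ j).locally_periodic 0
  set Q := ∏ j, q j with hQ
  have hQ0 : 0 < Q := Finset.prod_pos fun j _ => hq j
  choose C hC using fun j => hper j Q (Finset.dvd_prod_of_mem q (Finset.mem_univ j))
  set C₁ := Finset.univ.sup C
  have hfper : ∀ w z (u : Fin t → ℕ), ¬ NearZero (nnp lam w) 0 C₁ (Fin.cons z u : Fin (t + 1) → ℕ) →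
      f w (Fin.cons z u : Fin (t + 1) → ℕ) = f w (Fin.cons (z + Q) u : Fin (t + 1) → ℕ) := by
    intro w z u hz
    refine FinMonoid.pick_congr fun j => ?_
    rw [hC j w _ fun h => hz (h.mono (Finset.le_sup (Finset.mem_univ j))), Fin.update_cons_zero,
      Fin.cons_zero]
  set N := Q * Nat.card G.carrier with hN
  have hN0 : 0 < N := Nat.mul_pos hQ0 Nat.card_pos
  -- The enlarged constant ensures that, for `z` outside the chains, no position of the window
  -- starting at `z` is exceptional.
  obtain ⟨L, hL⟩ := exists_chains_of_nearZero t (C₁ + C₁ * N)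
  have hW : ∀ w (u : Fin t → ℕ) z, z ∉ {z | ∃ τ ∈ L, z ∈ τ.points (nnp lam w) u} →
      rangeProd (fun i => f w (Fin.cons (z + i) u : Fin (t + 1) → ℕ)) N = 1 := by
    intro w u z hz
    refine rangeProd_eq_one_of_periodic fun i hi => ?_
    rw [← add_assoc]
    exact hfper w (z + i) u fun h => hz (hL _ _ _ (h.of_add (by omega)))
  have hconst : ∀ i : ℕ, DefinableFun lam 𝓜 fun w (u : Fin t → ℕ) =>
      f w (Fin.cons i u : Fin (t + 1) → ℕ) := fun i =>
    (hf.comp_term hG hK (Fin.cons (.const i) fun j => .var j : Fin (t + 1) → Term t)).congr 0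
      fun w _ u => congrArg _ (funext (Fin.cases (by simp) fun j => by simp))
  have hshift : ∀ i : ℕ, DefinableFun lam 𝓜 fun w (v : Fin (t + 1) → ℕ) =>
      f w (Fin.cons (v 0 + i) (Fin.tail v) : Fin (t + 1) → ℕ) := fun i =>
    (hf.comp_term hG hK (Fin.cons (.add (.var 0) (.const i)) fun j => .var j.succ :
      Fin (t + 1) → Term (t + 1))).congr 0
      fun w _ u => congrArg _ (funext (Fin.cases (by simp) fun j => by simp [Fin.tail]))
  have hmod : ∀ j : Fin N, Definable lam 𝓜 fun _ (v : Fin (t + 1) → ℕ) => v 0 % N = j := fun j =>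
    (definable_modEq hN0 (.var 0) (.const j)).congr' fun w v => by
      simp [Nat.ModEq, Nat.mod_eq_of_lt j.2]
  have hE : ∀ j : Fin N, DefinableFun lam 𝓜 _ := fun j =>
    (DefinableFun.rangeProd hconst j).comp₂ (DefinableFun.limProd_chains hG hK hunit L
      (.ite (hmod j) (DefinableFun.rangeProd hshift N) (definableFun_const 1))) fun a b => a * b
  refine (Definable.forall fun j => hE j m).congr 0 fun w hw u => ?_
  rw [Formula.sat_quant]
  have hfin : {z | ∃ τ ∈ L, z ∈ τ.points (nnp lam w) u}.Finite := by
    refine (L.finite_toSet.biUnion fun τ _ => τ.finite_points hw.1 u).subset ?_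
    rintro z ⟨τ, hτ, hz⟩
    exact Set.mem_biUnion hτ hz
  refine (eventually_rangeProd_eq_iff (fun i => f w (Fin.cons i u : Fin (t + 1) → ℕ)) hN0 hfin
    (hW w u) m).trans (forall_congr' fun j => ?_)
  simp only [Set.mem_ofPred_eq, Fin.cons_zero, Fin.tail_cons]
  congr!

end Collapse

end MonoidLogic

theorem mainTheorem3 {A : Type*} [Finite A] (lam : A)
    (S : Set MonoidLogic.FinMonoid) (G : MonoidLogic.FinMonoid)
    (hG : ∀ g : G.carrier, IsUnit g) (m : G.carrier) {t : ℕ}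
    (φ φ' : Fin G.K → MonoidLogic.Formula A (t + 1))
    (hφ : (MonoidLogic.Formula.quant G m φ).InLogic S)
    (hcollapse : ∀ j, MonoidLogic.CollapsesTo S lam (φ j) (φ' j)) :
    ∃ ψ : MonoidLogic.Formula A t,
      MonoidLogic.CollapsesTo S lam (MonoidLogic.Formula.quant G m φ) ψ ∧
      ψ.monoids ⊆ {G} ∪ ⋃ j, (φ' j).monoids := by
  open MonoidLogic in
  rcases Nat.eq_zero_or_pos G.K with hK | hK
  -- A trivial group offers no factor `≠ 1` to express anything with, but then the quantifier is
  -- always true.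
  · refine ⟨.eq (.const 0) (.const 0), ⟨.eq _ _, Set.empty_subset _, 0, fun r _ w _ _ a => ?_⟩,
      Set.empty_subset _⟩
    have h1 : ∀ g : G.carrier, g = 1 := fun g => by
      by_contra hg
      exact (hK ▸ G.enum.symm ⟨g, hg⟩ : Fin 0).elim0
    refine iff_of_true (Filter.Eventually.of_forall fun k => ?_) rfl
    rw [h1 m]
    exact h1 _
  · choose h1 h2 R h3 using hcollapse
    obtain ⟨ψ, hψ, hmon, R', hR'⟩ := definable_quant (lam := lam)
      (𝓜 := {G} ∪ ⋃ j, (φ' j).monoids) (Or.inl rfl) hK hG m h1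
      fun j => Set.subset_union_of_subset_right (Set.subset_iUnion (fun j => (φ' j).monoids) j) _
    refine ⟨ψ, ⟨hψ, hmon.trans ?_, max R' (Finset.univ.sup R), fun r hr w hw hpow a => ?_⟩, hmon⟩
    · exact Set.union_subset (Set.subset_union_left.trans hφ) (Set.iUnion_subset h2)
    · refine Iff.trans (b := (Formula.quant G m φ').Sat w a) ?_ (hR' w ⟨hw, r, (le_max_left _ _).trans hr, hpow⟩ a)
      rw [Formula.sat_quant, Formula.sat_quant]
      have : ∀ i, (G.pick fun j => (φ j).Sat w (Fin.cons i a : Fin (t + 1) → ℕ)) =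
          G.pick fun j => (φ' j).Sat w (Fin.cons i a : Fin (t + 1) → ℕ) := fun i =>
        FinMonoid.pick_congr fun j => h3 j r ((Finset.le_sup (Finset.mem_univ j)).trans
          ((le_max_right _ _).trans hr)) w hw hpow _
      simp only [this]
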